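/- Let $\lambda>0$. Let $\cdots<y_{-2}<y_{-1}<y_0\le 0<y_1<y_2<\cdots$ be the points of a homogeneous Poisson process of intensity $\lambda$ on $\mathbb{R}$, and let $(\mathcal{D}_k)_{k\in\mathbb{Z}}$ be Poisson processes of rate $1$ on $(0,\infty)$, independent of each other and of $(y_i)_{i\in\mathbb{Z}}$; $\mathcal{D}_k$ is the clock attached to the location $y_k$. Consider the slow-to-start traffic model in which cars $i\in\mathbb{Z}$ move from right to left: $\pi_i(t)\in\mathbb{R}$ is the position and $v_i(t)\in\{0,1\}$ the speed of car $i$ at time $t\ge 0$, the functions $v_i$ are right-continuous with left limits, the functions $\pi_i$ are absolutely continuous on bounded intervals, and almost surely, for all $i\in\mathbb{Z}$, \[ \pi_i(0)=y_i,\qquad v_i(0)=0,\qquad \dot\pi_i(t)=-v_i(t)\ \text{ for a.e. } t\ge 0, \] and: $v_i(t)=0$ whenever $\pi_i(t)=\pi_{i-1}(t)$; $v_i$ jumps from $1$ to $0$ only at times $t$ with $\pi_i(t)=\pi_{i-1}(t)$; and $v_i$ jumps from $0$ to $1$ at rate $1$ while $\pi_i(t)>\pi_{i-1}(t)$, namely,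 if $v_i(t-)=0$ then $v_i(t)=1$ if and only if $\pi_i(t)>\pi_{i-1}(t)$, $\pi_i(t)=y_k$ for some $k\in\mathbb{Z}$ and $t\in\mathcal{D}_k$. Then the mean velocity of each car $i\in\mathbb{Z}$ satisfies, almost surely, \[ \frac{-\pi_i(t)}{t}\ \longrightarrow\ \min\Bigl\{\frac1\lambda,\,1\Bigr\}\qquad\text{as } t\to\infty . \] -/

import Mathlib

open Filter Topology MeasureTheory ProbabilityTheory

/-- The random set `X` is a homogeneous Poisson (point) process of intensity `rate` on `ℝ`:
the number of points in a Borel set of finite length is Poisson distributed with mean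
`rate` times the length, and the numbers of points in disjoint Borel sets are independent. -/
structure IsPoissonProcess {Ω : Type*} [MeasurableSpace Ω] (P : Measure Ω) (rate : ℝ)
    (X : Ω → Set ℝ) : Prop where
  hasLaw_count : ∀ B : Set ℝ, MeasurableSet B → volume B ≠ ⊤ →
    HasLaw (fun ω => (X ω ∩ B).encard)
      ((poissonMeasure (rate * (volume B).toReal).toNNReal).map (fun n : ℕ => (n : ℕ∞))) P
  indep_count : ∀ (n : ℕ) (B : Fin n → Set ℝ), (∀ k, MeasurableSet (B k)) →
    Pairwise (fun k l => Disjoint (B k) (B l)) →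
    iIndepFun (fun (k : Fin n) (ω : Ω) => (X ω ∩ B k).encard) P

/-- The initial car positions: the points of a Poisson process of intensity `rate`, labelled
increasingly so that `⋯ < y (-1) < y 0 ≤ 0 < y 1 < ⋯`. -/
structure IsLabelledPoisson {Ω : Type*} [MeasurableSpace Ω] (P : Measure Ω) (rate : ℝ)
    (y : ℤ → Ω → ℝ) : Prop where
  measurable : ∀ i, Measurable (y i)
  poisson : IsPoissonProcess P rate (fun ω => Set.range (fun i => y i ω))
  strictMono : ∀ᵐ ω ∂P, StrictMono (fun i => y i ω)
  label : ∀ᵐ ω ∂P, y 0 ω ≤ 0 ∧ 0 < y 1 ω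

/-- The set of points of the clock whose successive waiting times are `ξ 0, ξ 1, ξ 2, …`, that is,
`{ξ 0, ξ 0 + ξ 1, ξ 0 + ξ 1 + ξ 2, …}`. If the `ξ l` are i.i.d. exponential of parameter 1, this is
a Poisson process of rate 1 on `(0, ∞)`. -/
def clockPoints (ξ : ℕ → ℝ) : Set ℝ :=
  Set.range (fun l => ∑ m ∈ Finset.range (l + 1), ξ m)

/-- The family `(clockPoints (ξ k))`, `k ∈ ℤ`, consists of independent rate 1 Poisson processes on
`(0, ∞)` that are independent of the initial positions `y`. -/
structure AreIndepClocks {Ω : Type*} [MeasurableSpace Ω] (P : Measure Ω)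
    (y : ℤ → Ω → ℝ) (ξ : ℤ → ℕ → Ω → ℝ) : Prop where
  measurable : ∀ k l, Measurable (ξ k l)
  hasLaw : ∀ k l, HasLaw (ξ k l) (expMeasure 1) P
  iIndep : iIndepFun (fun (p : ℤ × ℕ) (ω : Ω) => ξ p.1 p.2 ω) P
  indep_init : IndepFun (fun ω (i : ℤ) => y i ω) (fun ω (p : ℤ × ℕ) => ξ p.1 p.2 ω) P

/-- The slow-to-start dynamics, for one realization of the initial positions `y` and of the clocks
`C k`, where `C k` is the set of ringing times of the clock attached to the location `y k`.
`pos i t` and `v i t` are position and speed of car `i` at time `t ≥ 0`; cars move to the left. -/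
structure IsSlowToStart (y : ℤ → ℝ) (C : ℤ → Set ℝ) (pos v : ℤ → ℝ → ℝ) : Prop where
  pos_zero : ∀ i, pos i 0 = y i
  speed_zero : ∀ i, v i 0 = 0
  /-- speeds are 0 or 1 -/
  speed_mem : ∀ i t, 0 ≤ t → v i t = 0 ∨ v i t = 1
  /-- speeds are right-continuous … -/
  speed_right : ∀ i t, 0 ≤ t → ∀ᶠ s in 𝓝[>] t, v i s = v i t
  /-- … with left limits -/
  speed_left : ∀ i t, 0 < t →
    (∀ᶠ s in 𝓝[<] t, v i s = 0) ∨ (∀ᶠ s in 𝓝[<] t, v i s = 1)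
  /-- the position is absolutely continuous, with derivative `-v i t` for almost every `t` -/
  pos_eq : ∀ i t, 0 ≤ t → pos i t = pos i 0 - ∫ s in (0 : ℝ)..t, v i s
  /-- a stopped car departs exactly when it is not blocked by the car ahead and the clock of its
  location rings; thus, while it is not blocked, its speed jumps from 0 to 1 at rate 1 -/
  start_iff : ∀ i t, 0 < t → (∀ᶠ s in 𝓝[<] t, v i s = 0) →
    (v i t = 1 ↔ pos (i - 1) t < pos i t ∧ ∃ k, pos i t = y k ∧ t ∈ C k)
  /-- a car that is at the position of the car ahead of it has speed 0 -/
  blocked : ∀ i t, 0 ≤ t → pos i t = pos (i - 1) t → v i t = 0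
  /-- a moving car stops only by colliding with the car ahead of it -/
  stop_only : ∀ i t, 0 < t → (∀ᶠ s in 𝓝[<] t, v i s = 1) → v i t = 0 →
    pos i t = pos (i - 1) t

/-!
Car `k + n` leaves the location `y k` at a time `exitTime y x n k - y k`, where `exitTime` satisfies
a recursion in which car `k + n + 1` at `y k` only interacts with the arrival of the same car from
`y (k + 1)` and with the departure of car `k + n` from `y k` (`IsSlowToStart.departure`). Each
location thus is a single-server queue that dies when it is empty for the first time.

In a frame moving with speed 1, the cars leaving `y k` behave like the customers leaving a
single-server queue with arrivals `y k, y (k + 1), …`: the server of `y k` uses its own clock as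
long as its queue is busy, and then follows the server of `y (k + 1)`. By the memoryless property,
switching between the two keeps the service times `serviceTime y x n k`, `n = 0, 1, …`, independent
and exponential of parameter 1 (`AreIndepClocks.hasLaw_revealed_serviceTime`).

With `R m n` the sum of the service times of the cars `k + m, …, k + n` in the queue started at
`y k`, the queue representation gives `exitTime y x n k = max_{m ≤ n} (y (k + m) + R m n)`.
For a fixed car `i` and `k = i - n`, the law of `R m n` is known exactly for each `n`, although the joint law for
different `n` is not; Chernoff bounds and the Borel–Cantelli lemma therefore suffice to replace
`R m n` by `n - m`, up to an error `o(n)`. Since `y (i - n) ~ -n / lam` by the strong law of large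
numbers for the Poisson counts, the exit time of car `i` from `y (i - n)` is, in the moving frame,
`n * max (1 - 1 / lam) 0 + o(n)` (`tendsto_exitTime_div`). Hence car `i` reaches distance `n / lam`
after time `n * max 1 (1 / lam) + o(n)`, and its mean velocity is the quotient `min (1 / lam) 1`.
-/

open scoped ENNReal

/-! ### Exit times in the moving frame -/

/-- `exitTime y x n k` is the time at which car `k + n` leaves the location `y k`, plus `y k`; that
is, the exit time in a frame that moves to the left at speed 1. In this frame, a car that leaves
`y (k + 1)` at time `s` and does not stop reaches `y k` at the same time `s`. Here `x (k, l)` is the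
`l`-th waiting time of the clock at `y k`: if car `k + n + 1` arrives at `y k` not later than
car `k + n` leaves, it waits for the next ring, otherwise it passes without stopping. -/
noncomputable def exitTime (y : ℤ → ℝ) (x : ℤ × ℕ → ℝ) : ℕ → ℤ → ℝ
  | 0, k => y k + x (k, 0)
  | n + 1, k =>
    if exitTime y x n (k + 1) ≤ exitTime y x n k then exitTime y x n k + x (k, n + 1)
    else exitTime y x n (k + 1)

theorem exitTime_lt_succ {y : ℤ → ℝ} {x : ℤ × ℕ → ℝ} (hx : ∀ p, 0 < x p) (n : ℕ) (k : ℤ) :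
    exitTime y x n k < exitTime y x (n + 1) k := by
  rw [exitTime]
  split_ifs with h
  · linarith [hx (k, n + 1)]
  · exact not_le.1 h

theorem exitTime_strictMono {y : ℤ → ℝ} {x : ℤ × ℕ → ℝ} (hx : ∀ p, 0 < x p) (k : ℤ) :
    StrictMono fun n => exitTime y x n k :=
  strictMono_nat_of_lt_succ fun n => exitTime_lt_succ hx n k

theorem lt_exitTime {y : ℤ → ℝ} {x : ℤ × ℕ → ℝ} (hx : ∀ p, 0 < x p) (n : ℕ) (k : ℤ) :
    y k < exitTime y x n k := by
  refine lt_of_lt_of_le ?_ ((exitTime_strictMono hx k).monotone n.zero_le)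
  simpa [exitTime] using hx (k, 0)

/-- As long as cars queue up at `y k`, every ring of its clock releases exactly one of them. -/
theorem exitTime_eq_sum {y : ℤ → ℝ} {x : ℤ × ℕ → ℝ} (hx : ∀ p, 0 < x p) (n : ℕ) (k : ℤ)
    (h : exitTime y x n (k + 1) ≤ exitTime y x n k) :
    exitTime y x n k = y k + ∑ m ∈ Finset.range (n + 1), x (k, m) := by
  induction n with
  | zero => simp [exitTime]
  | succ n ih =>
    by_cases h' : exitTime y x n (k + 1) ≤ exitTime y x n k
    · rw [Finset.sum_range_succ, exitTime, if_pos h', ih h', add_assoc]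
    · -- a queue that has been empty once stays empty
      rw [exitTime.eq_2 y x k n, if_neg h'] at h
      exact absurd h (not_le.2 (exitTime_lt_succ hx n (k + 1)))

/-- `serviceStart y x n k` is the moving-frame time from which car `k + n` is at the head of the
queue in the single-server queue with arrival times `y k, y (k + 1), …`. -/
noncomputable def serviceStart (y : ℤ → ℝ) (x : ℤ × ℕ → ℝ) : ℕ → ℤ → ℝ
  | 0, k => y k
  | n + 1, k => max (exitTime y x n k) (y (k + (n + 1 : ℕ)))

/-- The effective service time of car `k + n` in the single-server queue with arrival times
`y k, y (k + 1), …` and departure times `exitTime y x n k`. -/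
noncomputable def serviceTime (y : ℤ → ℝ) (x : ℤ × ℕ → ℝ) (n : ℕ) (k : ℤ) : ℝ :=
  exitTime y x n k - serviceStart y x n k

theorem exitTime_succ_left_le {y : ℤ → ℝ} {x : ℤ × ℕ → ℝ} (hx : ∀ p, 0 < x p) (n : ℕ) (k : ℤ) :
    exitTime y x n (k + 1) ≤ exitTime y x (n + 1) k := by
  rw [exitTime.eq_2 y x k n]
  split_ifs with h
  · linarith [hx (k, n + 1)]
  · exact le_rfl

theorem serviceStart_succ_left_le {y : ℤ → ℝ} {x : ℤ × ℕ → ℝ} (hx : ∀ p, 0 < x p) (n : ℕ) (k : ℤ) :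
    serviceStart y x n (k + 1) ≤ serviceStart y x (n + 1) k := by
  cases n with
  | zero => simp [serviceStart]
  | succ n =>
    have e : k + 1 + ((n + 1 : ℕ) : ℤ) = k + ((n + 1 + 1 : ℕ) : ℤ) := by push_cast; ring
    rw [serviceStart, serviceStart, e]
    exact max_le_max (exitTime_succ_left_le hx n k) le_rfl

theorem serviceStart_lt_exitTime {y : ℤ → ℝ} {x : ℤ × ℕ → ℝ} (hx : ∀ p, 0 < x p)
    (n : ℕ) (k : ℤ) : serviceStart y x n k < exitTime y x n k := by
  induction n generalizing k with
  | zero => simpa [serviceStart] using lt_exitTime hx 0 k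
  | succ n ih =>
    rw [serviceStart, max_lt_iff]
    refine ⟨exitTime_lt_succ hx n k, lt_of_lt_of_le ?_ (exitTime_succ_left_le hx n k)⟩
    refine lt_of_le_of_lt ?_ (ih (k + 1))
    cases n with
    | zero => simp [serviceStart]
    | succ n =>
      have e : k + 1 + ((n + 1 : ℕ) : ℤ) = k + ((n + 1 + 1 : ℕ) : ℤ) := by push_cast; ring
      rw [serviceStart, ← e]
      exact le_max_right _ _

/-- The queue started one location further to the left uses the service times of the present queue
until it merges with it: its next service time is either the remaining service time of the present
queue or, if its own clock is the one that counts, a fresh waiting time. -/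
theorem serviceTime_succ {y : ℤ → ℝ} {x : ℤ × ℕ → ℝ} (hx : ∀ p, 0 < x p) (n : ℕ) (k : ℤ) :
    serviceTime y x (n + 1) k =
      if serviceTime y x n (k + 1) ≤ serviceStart y x (n + 1) k - serviceStart y x n (k + 1)
      then x (k, n + 1)
      else serviceTime y x n (k + 1) -
        (serviceStart y x (n + 1) k - serviceStart y x n (k + 1)) := by
  have h1 : y (k + (n + 1 : ℕ)) ≤ serviceStart y x n (k + 1) := by
    cases n with
    | zero => simp [serviceStart]
    | succ n =>
      have e : k + 1 + ((n + 1 : ℕ) : ℤ) = k + ((n + 1 + 1 : ℕ) : ℤ) := by push_cast; ring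
      rw [serviceStart, ← e]
      exact le_max_right _ _
  have h2 := serviceStart_lt_exitTime (y := y) hx n (k + 1)
  have h3 : (exitTime y x n (k + 1) ≤ exitTime y x n k) ↔
      serviceTime y x n (k + 1) ≤ serviceStart y x (n + 1) k - serviceStart y x n (k + 1) := by
    rw [serviceTime, sub_le_sub_iff_right, serviceStart, le_max_iff]
    constructor
    · exact Or.inl
    · rintro (h | h)
      · exact h
      · linarith
  simp only [← h3]
  rw [serviceTime, exitTime.eq_2 y x k n]
  split_ifs with h
  · have : serviceStart y x (n + 1) k = exitTime y x n k := by
      rw [serviceStart]; exact max_eq_left (by linarith)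
    rw [this]; ring
  · rw [serviceTime]; ring

/-! ### Single-server queue bounds for the exit times -/

/-- Upper half of the formula that expresses the departure times of a single-server queue as maxima
over the first customer of the current busy period. -/
theorem exitTime_le_of_forall {y : ℤ → ℝ} {x : ℤ × ℕ → ℝ} (n : ℕ) (k : ℤ) (c : ℝ)
    (h : ∀ m ≤ n, y (k + m) + ∑ l ∈ Finset.Ico m (n + 1), serviceTime y x l k ≤ c) :
    exitTime y x n k ≤ c := by
  induction n generalizing c with
  | zero =>
    have := h 0 le_rfl
    simp only [Nat.cast_zero, add_zero, zero_add, Nat.Ico_succ_singleton, Finset.sum_singleton,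
      serviceTime, serviceStart] at this
    linarith
  | succ n ih =>
    have h1 : exitTime y x n k ≤ c - serviceTime y x (n + 1) k := by
      refine ih _ fun m hm => ?_
      have := h m (by omega)
      rw [Finset.sum_Ico_succ_top (by omega)] at this
      linarith
    have h2 := h (n + 1) le_rfl
    simp only [Nat.Ico_succ_singleton, Finset.sum_singleton] at h2
    have h3 : serviceStart y x (n + 1) k ≤ c - serviceTime y x (n + 1) k := by
      rw [serviceStart]; exact max_le h1 (by linarith)
    rw [serviceTime] at h3
    linarith

theorem add_sum_serviceTime_le_exitTime {y : ℤ → ℝ} {x : ℤ × ℕ → ℝ} (n : ℕ) (k : ℤ) :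
    y k + ∑ l ∈ Finset.Ico 0 (n + 1), serviceTime y x l k ≤ exitTime y x n k := by
  induction n with
  | zero => simp [serviceTime, serviceStart]
  | succ n ih =>
    rw [Finset.sum_Ico_succ_top (by omega), serviceTime, serviceStart]
    linarith [le_max_left (exitTime y x n k) (y (k + (n + 1 : ℕ)))]

/-- Cars move at speed at most 1. -/
theorem init_le_exitTime {y : ℤ → ℝ} {x : ℤ × ℕ → ℝ} (hx : ∀ p, 0 < x p) (n : ℕ) (k : ℤ) :
    y (k + n) ≤ exitTime y x n k := by
  refine le_trans ?_ (serviceStart_lt_exitTime hx n k).le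
  cases n with
  | zero => simp [serviceStart]
  | succ n => exact le_max_right _ _

/-! ### The dynamics for a fixed realization -/

/-- A right-continuous function with discrete values keeps its value on `[a, b)` if it cannot lose
it at the end of an interval on which it has kept it. -/
theorem eqOn_Ico_of_right_continuous {f : ℝ → ℝ} {a b c : ℝ} (ha : f a = c)
    (hr : ∀ t, a ≤ t → ∀ᶠ s in 𝓝[>] t, f s = f t)
    (hl : ∀ t, a < t → t < b → (∀ s ∈ Set.Ico a t, f s = c) → f t = c) :
    ∀ t ∈ Set.Ico a b, f t = c := by
  by_contra! hcon
  obtain ⟨t₀, ht₀, hft₀⟩ := hcon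
  set S : Set ℝ := {t | t ∈ Set.Ico a b ∧ f t ≠ c} with hS
  have hne : S.Nonempty := ⟨t₀, ht₀, hft₀⟩
  have hbdd : BddBelow S := ⟨a, fun t ht => ht.1.1⟩
  set τ := sInf S
  have haτ : a ≤ τ := le_csInf hne fun t ht => ht.1.1
  have hτb : τ < b := (csInf_le hbdd ⟨ht₀, hft₀⟩).trans_lt ht₀.2
  have hbefore : ∀ s ∈ Set.Ico a τ, f s = c := by
    intro s hs
    by_contra hfs
    exact absurd (csInf_le hbdd (show s ∈ S from ⟨⟨hs.1, hs.2.trans hτb⟩, hfs⟩)) (not_le.2 hs.2)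
  have hτ : f τ = c := by
    rcases haτ.eq_or_lt with h | h
    · rw [← h, ha]
    · exact hl τ h hτb hbefore
  obtain ⟨u, hu, hu'⟩ := mem_nhdsGT_iff_exists_Ioo_subset.1 (hr τ haτ)
  obtain ⟨s, hs, hsu⟩ := exists_lt_of_csInf_lt hne (show sInf S < u from hu)
  have hτs : τ ≤ s := csInf_le hbdd hs
  rcases hτs.eq_or_lt with h | h
  · exact hs.2 (h ▸ hτ)
  · exact hs.2 ((hu' ⟨h, hsu⟩ : f s = f τ).trans hτ)

theorem eventually_nhdsLT_of_Ico {f : ℝ → ℝ} {a t c : ℝ} (hat : a < t)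
    (h : ∀ s ∈ Set.Ico a t, f s = c) : ∀ᶠ s in 𝓝[<] t, f s = c := by
  filter_upwards [Ioo_mem_nhdsLT hat] with s hs using h s ⟨hs.1.le, hs.2⟩

namespace IsSlowToStart

variable {y : ℤ → ℝ} {C : ℤ → Set ℝ} {pos v : ℤ → ℝ → ℝ}

theorem intervalIntegrable (h : IsSlowToStart y C pos v) (i : ℤ) {a b : ℝ} (ha : 0 ≤ a)
    (hb : 0 ≤ b) : IntervalIntegrable (v i) volume a b := by
  have key : ∀ c : ℝ, 0 ≤ c → IntegrableOn (v i) (Set.Icc 0 c) volume := by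
    intro c hc
    refine LocallyIntegrableOn.integrableOn_isCompact (fun t ht => ?_) isCompact_Icc
    -- near `t` the speed is constant on either side of `t`
    have hconst : ∀ (l : Filter ℝ) (r : ℝ), l ≤ 𝓝 t → (∀ᶠ s in l, v i s = r) →
        l.IsMeasurablyGenerated → IntegrableAtFilter (v i) l volume := by
      intro l r hl hv _
      have h1 : IntegrableAtFilter (fun _ : ℝ => r) l volume :=
        ((continuous_const.locallyIntegrable (μ := volume)) t).filter_mono hl
      obtain ⟨s, hs, hint⟩ := h1
      obtain ⟨u, hu, hum, hsub⟩ :=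
        Filter.IsMeasurablyGenerated.exists_measurable_subset (Filter.inter_mem hs hv)
      exact ⟨u, hu, (hint.mono_set fun z hz => (hsub hz).1).congr_fun
        (fun z hz => (hsub hz).2.symm) hum⟩
    have hle : 𝓝[Set.Icc 0 c] t ≤ (𝓝[Set.Icc 0 c ∩ Set.Iio t] t ⊔ pure t) ⊔ 𝓝[>] t := by
      have : Set.Icc 0 c ⊆ ((Set.Icc 0 c ∩ Set.Iio t) ∪ {t}) ∪ Set.Ioi t := by
        intro s hs
        rcases lt_trichotomy s t with h | h | h
        · exact Or.inl (Or.inl ⟨hs, h⟩)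
        · exact Or.inl (Or.inr h)
        · exact Or.inr h
      refine (nhdsWithin_mono t this).trans ?_
      rw [nhdsWithin_union, nhdsWithin_union, nhdsWithin_singleton]
    refine IntegrableAtFilter.filter_mono hle ?_
    rw [IntegrableAtFilter.sup_iff, IntegrableAtFilter.sup_iff]
    refine ⟨⟨?_, ?_⟩, ?_⟩
    · rcases ht.1.eq_or_lt with h0 | h0
      · have : Set.Icc 0 c ∩ Set.Iio t = ∅ := by
          ext s; simp only [Set.mem_inter_iff, Set.mem_Icc, Set.mem_Iio, Set.mem_empty_iff_false,
            iff_false]; rintro ⟨⟨h1, _⟩, h2⟩; linarith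
        rw [this, nhdsWithin_empty]
        exact ⟨∅, mem_bot, integrableOn_empty⟩
      · have hsub : 𝓝[Set.Icc 0 c ∩ Set.Iio t] t ≤ 𝓝[<] t :=
          nhdsWithin_mono t Set.inter_subset_right
        refine IntegrableAtFilter.filter_mono hsub ?_
        rcases h.speed_left i t h0 with h1 | h1
        · exact hconst _ 0 nhdsWithin_le_nhds h1 inferInstance
        · exact hconst _ 1 nhdsWithin_le_nhds h1 inferInstance
    · exact ⟨{t}, Filter.mem_pure.2 rfl, by simp⟩
    · exact hconst _ _ nhdsWithin_le_nhds (h.speed_right i t ht.1) inferInstance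
  have key' : ∀ c : ℝ, 0 ≤ c → IntervalIntegrable (v i) volume 0 c := fun c hc =>
    (intervalIntegrable_iff_integrableOn_Icc_of_le hc).2 (key c hc)
  exact (key' a ha).symm.trans (key' b hb)

theorem pos_eq_sub (h : IsSlowToStart y C pos v) (i : ℤ) {a b : ℝ} (ha : 0 ≤ a) (hab : a ≤ b) :
    pos i b = pos i a - ∫ s in a..b, v i s := by
  rw [h.pos_eq i b (ha.trans hab), h.pos_eq i a ha,
    ← intervalIntegral.integral_add_adjacent_intervals
    (h.intervalIntegrable i le_rfl ha) (h.intervalIntegrable i ha (ha.trans hab))]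
  ring

theorem pos_antitone (h : IsSlowToStart y C pos v) (i : ℤ) {a b : ℝ} (ha : 0 ≤ a) (hab : a ≤ b) :
    pos i b ≤ pos i a := by
  rw [h.pos_eq_sub i ha hab]
  have : 0 ≤ ∫ s in a..b, v i s := by
    refine intervalIntegral.integral_nonneg hab fun s hs => ?_
    rcases h.speed_mem i s (ha.trans hs.1) with h1 | h1 <;> rw [h1]
    norm_num
  linarith

theorem pos_of_speed_eq (h : IsSlowToStart y C pos v) (i : ℤ) {a b c : ℝ} (ha : 0 ≤ a)
    (hab : a ≤ b) (hv : ∀ s ∈ Set.Ico a b, v i s = c) : pos i b = pos i a - c * (b - a) := by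
  rw [h.pos_eq_sub i ha hab]
  have : ∫ s in a..b, v i s = ∫ _ in a..b, c := by
    refine intervalIntegral.integral_congr_ae ?_
    have hb : ∀ᵐ s : ℝ, s ≠ b := by simp [ae_iff]
    filter_upwards [hb] with s hs hs'
    rw [Set.uIoc_of_le hab] at hs'
    exact hv s ⟨hs'.1.le, lt_of_le_of_ne hs'.2 hs⟩
  rw [this, intervalIntegral.integral_const, smul_eq_mul, mul_comm]

theorem pos_lt_of_speed_one (h : IsSlowToStart y C pos v) (i : ℤ) {a b : ℝ} (ha : 0 ≤ a)
    (hab : a < b) (hv : v i a = 1) : pos i b < pos i a := by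
  obtain ⟨u, hu, hu'⟩ := mem_nhdsGT_iff_exists_Ioo_subset.1 (h.speed_right i a ha)
  have hu : a < u := hu
  have hc : a < min u b := lt_min hu hab
  have h1 : pos i (min u b) = pos i a - 1 * (min u b - a) := by
    refine h.pos_of_speed_eq i ha hc.le fun s hs => ?_
    rcases hs.1.eq_or_lt with h1 | h1
    · rw [← h1, hv]
    · exact (hu' ⟨h1, hs.2.trans_le (min_le_left _ _)⟩ : v i s = v i a).trans hv
  have h2 := h.pos_antitone i (ha.trans hc.le) (min_le_right u b)
  linarith

/-- A car stopped at `y k` waits there as long as the clock of `y k` does not ring. -/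
theorem wait (h : IsSlowToStart y C pos v) (hy : Function.Injective y) {i k : ℤ} {a b : ℝ}
    (ha : 0 ≤ a) (hp : pos i a = y k) (hv : v i a = 0) (hC : ∀ t ∈ Set.Ioo a b, t ∉ C k) :
    ∀ t ∈ Set.Ico a b, v i t = 0 := by
  refine eqOn_Ico_of_right_continuous hv (fun t ht => h.speed_right i t (ha.trans ht)) ?_
  intro t hat htb hs
  rcases h.speed_mem i t (ha.trans hat.le) with h0 | h1
  · exact h0
  · obtain ⟨_, k', hk', hC'⟩ :=
      (h.start_iff i t (ha.trans_lt hat) (eventually_nhdsLT_of_Ico hat hs)).1 h1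
    have hpt : pos i t = y k := by
      rw [h.pos_of_speed_eq i ha hat.le hs, hp]; ring
    rw [hpt] at hk'
    rw [← hy hk'] at hC'
    exact absurd hC' (hC t ⟨hat, htb⟩)

/-- A car at the head of the queue at `y k` leaves at the next ring of the clock of `y k`. -/
theorem depart (h : IsSlowToStart y C pos v) (hy : Function.Injective y) {i k : ℤ} {a b : ℝ}
    (ha : 0 ≤ a) (hab : a < b) (hp : pos i a = y k) (hv : v i a = 0)
    (hC : ∀ t ∈ Set.Ioo a b, t ∉ C k) (hb : b ∈ C k) (hahead : pos (i - 1) b < y k) :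
    pos i b = y k ∧ v i b = 1 := by
  have hs := h.wait hy ha hp hv hC
  have hpb : pos i b = y k := by
    rw [h.pos_of_speed_eq i ha hab.le hs, hp]; ring
  refine ⟨hpb, ?_⟩
  rw [h.start_iff i b (ha.trans_lt hab) (eventually_nhdsLT_of_Ico hab hs), hpb]
  exact ⟨hahead, k, rfl, hb⟩

end IsSlowToStart

theorem clockPoints_mem (ξ : ℕ → ℝ) (l : ℕ) :
    ∑ m ∈ Finset.range (l + 1), ξ m ∈ clockPoints ξ := ⟨l, rfl⟩

theorem notMem_clockPoints_zero {ξ : ℕ → ℝ} (hξ : ∀ l, 0 < ξ l) :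
    ∀ t ∈ Set.Ioo 0 (ξ 0), t ∉ clockPoints ξ := by
  rintro _ ht ⟨l, rfl⟩
  have : ∑ m ∈ Finset.range 1, ξ m ≤ ∑ m ∈ Finset.range (l + 1), ξ m :=
    Finset.sum_le_sum_of_subset_of_nonneg (Finset.range_mono (by omega)) fun m _ _ => (hξ m).le
  simp only [Finset.range_one, Finset.sum_singleton] at this
  exact absurd ht.2 (not_lt.2 this)

theorem notMem_clockPoints_succ {ξ : ℕ → ℝ} (hξ : ∀ l, 0 < ξ l) (n : ℕ) :
    ∀ t ∈ Set.Ioo (∑ m ∈ Finset.range (n + 1), ξ m) (∑ m ∈ Finset.range (n + 2), ξ m),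
      t ∉ clockPoints ξ := by
  rintro _ ht ⟨l, rfl⟩
  have hmono : ∀ a b : ℕ, a ≤ b → ∑ m ∈ Finset.range a, ξ m ≤ ∑ m ∈ Finset.range b, ξ m :=
    fun a b hab =>
      Finset.sum_le_sum_of_subset_of_nonneg (Finset.range_mono hab) fun m _ _ => (hξ m).le
  rcases le_or_gt l n with hl | hl
  · exact absurd ht.1 (not_lt.2 (hmono _ _ (by omega)))
  · exact absurd ht.2 (not_lt.2 (hmono _ _ (by omega)))

/-- Car `i = k + n` leaves `y k` at time `exitTime y x n k - y k`. The last two clauses, which keep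
the induction on `n` going, bound its trajectory by the one that car `i + 1` follows, without
stopping, between `y (k + 1)` and `y k`. -/
theorem IsSlowToStart.departure {y : ℤ → ℝ} {x : ℤ × ℕ → ℝ} {pos v : ℤ → ℝ → ℝ}
    (h : IsSlowToStart y (fun k => clockPoints fun l => x (k, l)) pos v) (hy : StrictMono y)
    (hx : ∀ p, 0 < x p) (n : ℕ) (k i : ℤ) (hi : i = k + n) :
    pos i (exitTime y x n k - y k) = y k ∧ v i (exitTime y x n k - y k) = 1 ∧
    (∀ t, exitTime y x n (k + 1) - y (k + 1) ≤ t → t < exitTime y x n (k + 1) - y k →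
      pos i t < exitTime y x n (k + 1) - t) ∧
    pos i (exitTime y x n (k + 1) - y k) ≤ y k := by
  have hgap : ∀ k, y k < y (k + 1) := fun k => hy (by omega)
  have hTpos : ∀ n k, 0 < exitTime y x n k - y k := fun n k => sub_pos.2 (lt_exitTime hx n k)
  induction n generalizing k i with
  | zero =>
    obtain rfl : i = k := by simpa using hi
    have hle : ∀ t, 0 ≤ t → pos i t ≤ y i := fun t ht =>
      (h.pos_antitone i le_rfl ht).trans (h.pos_zero i).le
    have e : exitTime y x 0 i - y i = x (i, 0) := by simp [exitTime]
    have hahead : pos (i - 1) (x (i, 0)) < y i := by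
      refine (h.pos_antitone (i - 1) le_rfl (hx (i, 0)).le).trans_lt ?_
      rw [h.pos_zero]
      exact hy (by omega)
    have hd := h.depart hy.injective le_rfl (hx (i, 0)) (h.pos_zero i) (h.speed_zero i)
      (notMem_clockPoints_zero (ξ := fun l => x (i, l)) fun l => hx (i, l))
      ⟨0, by simp⟩ hahead
    rw [e]
    refine ⟨hd.1, hd.2, fun t ht1 ht2 => ?_, hle _ ?_⟩
    · have := hle t ((hTpos 0 (i + 1)).le.trans ht1)
      linarith
    · linarith [hTpos 0 (i + 1), hgap i]
  | succ n ih =>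
    obtain ⟨hp1, hv1, hU1, hU2⟩ := ih k (i - 1) (by rw [hi]; push_cast; ring)
    obtain ⟨hq1, hq2, -, -⟩ := ih (k + 1) i (by rw [hi]; push_cast; ring)
    set T' := exitTime y x n k - y k with hT'
    set T'' := exitTime y x n (k + 1) - y (k + 1) with hT''
    set A := exitTime y x n (k + 1) - y k with hA
    have hT'0 : 0 < T' := hTpos n k
    have hT''0 : 0 < T'' := hTpos n (k + 1)
    have hTA : T'' < A := by rw [hT'', hA]; linarith [hgap k]
    -- car `i` moves freely from `y (k + 1)` to `y k`, since car `i - 1` is ahead of it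
    have hmove : ∀ t ∈ Set.Ico T'' A, v i t = 1 := by
      refine eqOn_Ico_of_right_continuous hq2 (fun t ht => h.speed_right i t (hT''0.le.trans ht)) ?_
      intro t ht1 ht2 hs
      have hpt : pos i t = exitTime y x n (k + 1) - t := by
        rw [h.pos_of_speed_eq i hT''0.le ht1.le hs, hq1, hT'']; ring
      rcases h.speed_mem i t (hT''0.le.trans ht1.le) with h0 | h1
      · have := h.stop_only i t (hT''0.trans ht1) (eventually_nhdsLT_of_Ico ht1 hs) h0
        have := hU1 t ht1.le ht2
        linarith
      · exact h1
    have htraj : ∀ t, T'' ≤ t → t ≤ A → pos i t = exitTime y x n (k + 1) - t := by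
      intro t ht1 ht2
      rw [h.pos_of_speed_eq i hT''0.le ht1 (fun s hs => hmove s ⟨hs.1, hs.2.trans_le ht2⟩), hq1,
        hT'']
      ring
    have hpA : pos i A = y k := by rw [htraj A hTA.le le_rfl, hA]; ring
    have hA0 : 0 < A := hT''0.trans hTA
    have hlt := exitTime_lt_succ (y := y) hx n (k + 1)
    have hUs : (∀ t, exitTime y x (n + 1) (k + 1) - y (k + 1) ≤ t →
        t < exitTime y x (n + 1) (k + 1) - y k → pos i t < exitTime y x (n + 1) (k + 1) - t) ∧
        pos i (exitTime y x (n + 1) (k + 1) - y k) ≤ y k := by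
      constructor
      · intro t ht1 ht2
        rcases le_total t A with htA | htA
        · rw [htraj t (by rw [hT'']; linarith) htA]; linarith
        · have := h.pos_antitone i hA0.le htA
          linarith
      · rw [← hpA]
        exact h.pos_antitone i hA0.le (by rw [hA]; linarith)
    suffices hmain : pos i (exitTime y x (n + 1) k - y k) = y k ∧
        v i (exitTime y x (n + 1) k - y k) = 1 from ⟨hmain.1, hmain.2, hUs⟩
    by_cases hcase : exitTime y x n (k + 1) ≤ exitTime y x n k
    · -- car `i` joins the queue at `y k` behind car `i - 1`
      have hAT : A ≤ T' := by rw [hA, hT']; linarith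
      have hblock : ∀ t, A ≤ t → t ≤ T' → pos (i - 1) t = y k := by
        intro t ht1 ht2
        refine le_antisymm ((h.pos_antitone (i - 1) hA0.le ht1).trans hU2) ?_
        rw [← hp1]
        exact h.pos_antitone (i - 1) (hA0.le.trans ht1) ht2
      have hvA : v i A = 0 := h.blocked i A hA0.le (by rw [hpA, hblock A le_rfl hAT])
      have hwait : ∀ t ∈ Set.Ico A T', v i t = 0 := by
        refine eqOn_Ico_of_right_continuous hvA (fun t ht => h.speed_right i t (hA0.le.trans ht)) ?_
        intro t ht1 ht2 hs
        refine h.blocked i t (hA0.le.trans ht1.le) ?_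
        rw [h.pos_of_speed_eq i hA0.le ht1.le hs, hpA, hblock t ht1.le ht2.le]; ring
      have hpT : pos i T' = y k := by
        rw [h.pos_of_speed_eq i hA0.le hAT hwait, hpA]; ring
      have hvT : v i T' = 0 := h.blocked i T' hT'0.le (by rw [hpT, hp1])
      have hsum : T' = ∑ m ∈ Finset.range (n + 1), x (k, m) := by
        rw [hT', exitTime_eq_sum hx n k hcase]; ring
      have hT : exitTime y x (n + 1) k - y k = ∑ m ∈ Finset.range (n + 2), x (k, m) := by
        rw [exitTime, if_pos hcase, Finset.sum_range_succ, ← hsum, hT']; ring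
      have hTT : T' < exitTime y x (n + 1) k - y k := by
        rw [hT']; linarith [exitTime_lt_succ (y := y) hx n k]
      refine h.depart hy.injective hT'0.le hTT hpT hvT ?_ ?_ ?_
      · rw [hT, hsum]
        exact notMem_clockPoints_succ (ξ := fun l => x (k, l)) (fun l => hx (k, l)) n
      · rw [hT]
        exact clockPoints_mem (fun l => x (k, l)) (n + 1)
      · exact (h.pos_lt_of_speed_one (i - 1) hT'0.le hTT hv1).trans_eq hp1
    · -- car `i - 1` has already left `y k`
      have hAT : T' < A := by rw [hA, hT']; linarith
      have e : exitTime y x (n + 1) k - y k = A := by rw [exitTime, if_neg hcase]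
      rw [e]
      refine ⟨hpA, ?_⟩
      rcases h.speed_mem i A hA0.le with h0 | h1
      · have h1 := h.stop_only i A hA0 (eventually_nhdsLT_of_Ico hTA hmove) h0
        have h2 := h.pos_lt_of_speed_one (i - 1) hT'0.le hAT hv1
        linarith
      · exact h1

/-! ### The memoryless property of the exponential distribution -/

theorem lintegral_expMeasure_one {g : ℝ → ℝ≥0∞} (hg : Measurable g) :
    ∫⁻ u, g u ∂(expMeasure 1) = ∫⁻ u in Set.Ici 0, ENNReal.ofReal (Real.exp (-u)) * g u := by
  have h : expMeasure 1 = volume.withDensity (exponentialPDF 1) := rfl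
  have hm : Measurable (exponentialPDF 1) := by unfold exponentialPDF; fun_prop
  rw [h, lintegral_withDensity_eq_lintegral_mul _ hm hg, ← lintegral_indicator measurableSet_Ici]
  refine lintegral_congr fun u => ?_
  simp only [Pi.mul_apply, Set.indicator, Set.mem_Ici]
  split_ifs with hu
  · rw [exponentialPDF_of_nonneg hu]; simp
  · rw [exponentialPDF_of_neg (not_le.1 hu), zero_mul]

theorem expMeasure_one_ae_pos : ∀ᵐ u ∂(expMeasure 1), 0 < u := by
  have h : expMeasure 1 = volume.withDensity (exponentialPDF 1) := rfl
  rw [ae_iff, h]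
  simp only [not_lt]
  rw [show {a : ℝ | a ≤ 0} = Set.Iic 0 from rfl, withDensity_apply _ measurableSet_Iic,
    ← setLIntegral_congr (Iio_ae_eq_Iic (μ := volume) (a := (0 : ℝ)))]
  exact lintegral_exponentialPDF_of_nonpos le_rfl

theorem lintegral_exp_mul_expMeasure_one {θ : ℝ} (hθ : θ < 1) :
    ∫⁻ u, ENNReal.ofReal (Real.exp (θ * u)) ∂(expMeasure 1) = ENNReal.ofReal (1 - θ)⁻¹ := by
  have h1 : 0 < 1 - θ := by linarith
  have h : expMeasure 1 = volume.withDensity (exponentialPDF 1) := rfl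
  have hm : Measurable (exponentialPDF 1) := by unfold exponentialPDF; fun_prop
  have hm' : Measurable (exponentialPDF (1 - θ)) := by unfold exponentialPDF; fun_prop
  rw [h, lintegral_withDensity_eq_lintegral_mul _ hm (by fun_prop)]
  calc _ = ∫⁻ u, ENNReal.ofReal (1 - θ)⁻¹ * exponentialPDF (1 - θ) u := by
        refine lintegral_congr fun u => ?_
        simp only [Pi.mul_apply, exponentialPDF_eq]
        split_ifs with hu
        · rw [← ENNReal.ofReal_mul (by positivity), ← ENNReal.ofReal_mul (by positivity),
            one_mul, one_mul, ← mul_assoc, inv_mul_cancel₀ h1.ne', one_mul, ← Real.exp_add]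
          congr 2; ring
        · simp
    _ = _ := by
        rw [lintegral_const_mul _ hm', lintegral_exponentialPDF_eq_one h1, mul_one]

theorem setLIntegral_Ioi_sub_expMeasure_one {d : ℝ} (hd : 0 ≤ d) {g : ℝ → ℝ≥0∞}
    (hg : Measurable g) :
    ∫⁻ u in Set.Ioi d, g (u - d) ∂(expMeasure 1) =
      ENNReal.ofReal (Real.exp (-d)) * ∫⁻ u, g u ∂(expMeasure 1) := by
  rw [← lintegral_indicator measurableSet_Ioi, lintegral_expMeasure_one,
    lintegral_expMeasure_one hg,
    setLIntegral_congr (Ioi_ae_eq_Ici (μ := volume) (a := (0 : ℝ))).symm,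
    setLIntegral_congr (Ioi_ae_eq_Ici (μ := volume) (a := (0 : ℝ))).symm,
    ← lintegral_indicator measurableSet_Ioi, ← lintegral_indicator measurableSet_Ioi,
    ← lintegral_const_mul _ (by
      refine Measurable.indicator ?_ measurableSet_Ioi
      fun_prop),
    ← lintegral_sub_right_eq_self (μ := volume) (fun u => ENNReal.ofReal (Real.exp (-d)) *
      (Set.Ioi (0 : ℝ)).indicator (fun u => ENNReal.ofReal (Real.exp (-u)) * g u) u) d]
  · refine lintegral_congr fun u => ?_
    by_cases hu : d < u
    · rw [Set.indicator_of_mem (show u ∈ Set.Ioi 0 from hd.trans_lt hu),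
        Set.indicator_of_mem (show u ∈ Set.Ioi d from hu),
        Set.indicator_of_mem (show u - d ∈ Set.Ioi 0 from sub_pos.2 hu), ← mul_assoc,
        ← ENNReal.ofReal_mul (by positivity), ← Real.exp_add]
      congr 3; ring
    · rw [Set.indicator_of_notMem (show u - d ∉ Set.Ioi 0 from fun h => hu (sub_pos.1 h)), mul_zero]
      by_cases hu0 : u ∈ Set.Ioi (0 : ℝ)
      · rw [Set.indicator_of_mem hu0, Set.indicator_of_notMem (show u ∉ Set.Ioi d from hu),
          mul_zero]
      · rw [Set.indicator_of_notMem hu0]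
  · refine Measurable.indicator ?_ measurableSet_Ioi
    fun_prop

/-- If an exponential variable `u` is stopped at `d`, then its remaining lifetime, replaced by a
fresh exponential variable `w` in case there is none, is exponential. -/
theorem lintegral_residual_expMeasure_one {d : ℝ} (hd : 0 ≤ d) {g : ℝ → ℝ≥0∞}
    (hg : Measurable g) :
    ∫⁻ u, ∫⁻ w, g (if u ≤ d then w else u - d) ∂(expMeasure 1) ∂(expMeasure 1) =
      ∫⁻ u, g u ∂(expMeasure 1) := by
  have : IsProbabilityMeasure (expMeasure 1) := isProbabilityMeasure_expMeasure one_pos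
  set c := ∫⁻ u, g u ∂(expMeasure 1)
  have htail : expMeasure 1 (Set.Ioi d) = ENNReal.ofReal (Real.exp (-d)) := by
    have := setLIntegral_Ioi_sub_expMeasure_one hd (g := fun _ => 1) measurable_const
    simpa using this
  rw [← lintegral_add_compl _ (measurableSet_Iic (a := d)), Set.compl_Iic]
  have h1 : ∫⁻ u in Set.Iic d, ∫⁻ w, g (if u ≤ d then w else u - d) ∂(expMeasure 1)
      ∂(expMeasure 1) = c * expMeasure 1 (Set.Iic d) := by
    rw [← setLIntegral_const]
    refine setLIntegral_congr_fun measurableSet_Iic fun u hu => ?_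
    simp only [if_pos (show u ≤ d from hu)]
    rfl
  have h2 : ∫⁻ u in Set.Ioi d, ∫⁻ w, g (if u ≤ d then w else u - d) ∂(expMeasure 1)
      ∂(expMeasure 1) = c * expMeasure 1 (Set.Ioi d) := by
    rw [htail, mul_comm, ← setLIntegral_Ioi_sub_expMeasure_one hd hg]
    refine setLIntegral_congr_fun measurableSet_Ioi fun u hu => ?_
    simp only [if_neg (not_le.2 (show d < u from hu)), lintegral_const, measure_univ, mul_one]
  rw [h1, h2, ← mul_add, ← Set.compl_Iic, measure_add_measure_compl measurableSet_Iic,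
    measure_univ, mul_one]

/-- The residual lifetime at a random time that depends only on `Z` is exponential and
independent of `Z`. -/
theorem hasLaw_prod_residual {Ω α : Type*} [MeasurableSpace Ω] [MeasurableSpace α]
    {P : Measure Ω} [IsProbabilityMeasure P] {Z : Ω → α} {U W : Ω → ℝ} {d : α → ℝ}
    (hZ : Measurable Z) (hU : Measurable U) (hW : Measurable W) (hd : Measurable d)
    (hd0 : ∀ z, 0 ≤ d z)
    (hUlaw : HasLaw U (expMeasure 1) P) (hWlaw : HasLaw W (expMeasure 1) P)
    (hZU : IndepFun Z U P) (hZUW : IndepFun (fun ω => (Z ω, U ω)) W P) :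
    HasLaw (fun ω => (Z ω, if U ω ≤ d (Z ω) then W ω else U ω - d (Z ω)))
      ((P.map Z).prod (expMeasure 1)) P := by
  have : IsProbabilityMeasure (expMeasure 1) := isProbabilityMeasure_expMeasure one_pos
  have : IsProbabilityMeasure (P.map Z) := Measure.isProbabilityMeasure_map hZ.aemeasurable
  have hlaw : P.map (fun ω => ((Z ω, U ω), W ω)) =
      ((P.map Z).prod (expMeasure 1)).prod (expMeasure 1) := by
    rw [(indepFun_iff_map_prod_eq_prod_map_map (hZ.prodMk hU).aemeasurable hW.aemeasurable).1 hZUW,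
      (indepFun_iff_map_prod_eq_prod_map_map hZ.aemeasurable hU.aemeasurable).1 hZU, hUlaw.map_eq,
      hWlaw.map_eq]
  set φ : (α × ℝ) × ℝ → α × ℝ :=
    fun q => (q.1.1, if q.1.2 ≤ d q.1.1 then q.2 else q.1.2 - d q.1.1) with hφ
  have hφm : Measurable φ := by
    refine Measurable.prodMk (by fun_prop) (Measurable.ite ?_ (by fun_prop) (by fun_prop))
    exact measurableSet_le (by fun_prop) (by fun_prop)
  have hcomp : (fun ω => (Z ω, if U ω ≤ d (Z ω) then W ω else U ω - d (Z ω))) =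
      φ ∘ fun ω => ((Z ω, U ω), W ω) := rfl
  refine ⟨by rw [hcomp]; exact (hφm.comp ((hZ.prodMk hU).prodMk hW)).aemeasurable, ?_⟩
  rw [hcomp, ← Measure.map_map hφm ((hZ.prodMk hU).prodMk hW), hlaw]
  refine Measure.ext_of_lintegral _ fun f hf => ?_
  have hfm : Measurable fun q => f (φ q) := hf.comp hφm
  rw [lintegral_map hf hφm, lintegral_prod _ hfm.aemeasurable,
    lintegral_prod _ hfm.lintegral_prod_right'.aemeasurable, lintegral_prod _ hf.aemeasurable]
  refine lintegral_congr fun z => ?_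
  exact lintegral_residual_expMeasure_one (hd0 z) (g := fun w => f (z, w)) (by fun_prop)

/-! ### The effective service times are independent exponential variables -/

theorem exitTime_congr {y : ℤ → ℝ} {x x' : ℤ × ℕ → ℝ} (n : ℕ) (k : ℤ)
    (h : ∀ p : ℤ × ℕ, k ≤ p.1 → p.1 + p.2 ≤ k + n → x p = x' p) :
    exitTime y x n k = exitTime y x' n k := by
  induction n generalizing k with
  | zero => simp only [exitTime]; rw [h (k, 0) (by simp) (by simp)]
  | succ n ih =>
    rw [exitTime, exitTime, ih k fun p h1 h2 => h p h1 (by push_cast; omega),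
      ih (k + 1) fun p h1 h2 => h p (by omega) (by push_cast; omega),
      h (k, n + 1) (by simp) (by simp)]

theorem serviceStart_congr {y : ℤ → ℝ} {x x' : ℤ × ℕ → ℝ} (n : ℕ) (k : ℤ)
    (h : ∀ p : ℤ × ℕ, k ≤ p.1 → p.1 + p.2 < k + n → x p = x' p) :
    serviceStart y x n k = serviceStart y x' n k := by
  cases n with
  | zero => rfl
  | succ n =>
    rw [serviceStart, serviceStart,
      exitTime_congr n k fun p h1 h2 => h p h1 (by push_cast; omega)]

theorem serviceTime_congr {y : ℤ → ℝ} {x x' : ℤ × ℕ → ℝ} (n : ℕ) (k : ℤ)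
    (h : ∀ p : ℤ × ℕ, k ≤ p.1 → p.1 + p.2 ≤ k + n → x p = x' p) :
    serviceTime y x n k = serviceTime y x' n k := by
  rw [serviceTime, serviceTime, exitTime_congr n k h,
    serviceStart_congr n k fun p h1 h2 => h p h1 h2.le]

theorem measurable_exitTime (n : ℕ) (k : ℤ) :
    Measurable fun e : (ℤ → ℝ) × (ℤ × ℕ → ℝ) => exitTime e.1 e.2 n k := by
  induction n generalizing k with
  | zero => simp only [exitTime]; fun_prop
  | succ n ih =>
    simp only [exitTime]
    refine Measurable.ite (measurableSet_le (ih _) (ih _)) ((ih _).add ?_) (ih _)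
    fun_prop

theorem measurable_serviceStart (n : ℕ) (k : ℤ) :
    Measurable fun e : (ℤ → ℝ) × (ℤ × ℕ → ℝ) => serviceStart e.1 e.2 n k := by
  cases n with
  | zero => simp only [serviceStart]; fun_prop
  | succ n =>
    simp only [serviceStart]
    refine (measurable_exitTime n k).max ?_
    fun_prop

theorem measurable_serviceTime (n : ℕ) (k : ℤ) :
    Measurable fun e : (ℤ → ℝ) × (ℤ × ℕ → ℝ) => serviceTime e.1 e.2 n k :=
  (measurable_exitTime n k).sub (measurable_serviceStart n k)

section Law

variable {Ω : Type*} [MeasurableSpace Ω]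

/-- The initial positions together with the waiting times that have an index in `A`; the other
waiting times are replaced by 0. -/
noncomputable def revealed (y : ℤ → Ω → ℝ) (ξ : ℤ → ℕ → Ω → ℝ) (A : Set (ℤ × ℕ)) (ω : Ω) :
    (ℤ → ℝ) × (ℤ × ℕ → ℝ) :=
  (fun i => y i ω, A.indicator fun p => ξ p.1 p.2 ω)

theorem measurable_indicator_pi (A : Set (ℤ × ℕ)) :
    Measurable fun x : ℤ × ℕ → ℝ => A.indicator x := by
  refine measurable_pi_lambda _ fun p => ?_
  by_cases hp : p ∈ A
  · simp only [Set.indicator_of_mem hp]; fun_prop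
  · simp only [Set.indicator_of_notMem hp]; fun_prop

variable {P : Measure Ω} {y : ℤ → Ω → ℝ} {ξ : ℤ → ℕ → Ω → ℝ}

theorem measurable_revealed (hy : ∀ i, Measurable (y i)) (hξ : ∀ k l, Measurable (ξ k l))
    (A : Set (ℤ × ℕ)) : Measurable (revealed y ξ A) :=
  (measurable_pi_lambda _ fun i => hy i).prodMk
    ((measurable_indicator_pi A).comp (measurable_pi_lambda _ fun p => hξ p.1 p.2))

/-- If `X` is independent of `(Y, Z)` and `Y` is independent of `Z`, then `(X, Y)` is independent
of `Z`. -/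
theorem indepFun_prodMk_of_indepFun [IsProbabilityMeasure P] {α β γ : Type*} [MeasurableSpace α]
    [MeasurableSpace β] [MeasurableSpace γ] {X : Ω → α} {Y : Ω → β} {Z : Ω → γ}
    (hX : Measurable X) (hY : Measurable Y) (hZ : Measurable Z)
    (h1 : IndepFun X (fun ω => (Y ω, Z ω)) P) (h2 : IndepFun Y Z P) :
    IndepFun (fun ω => (X ω, Y ω)) Z P := by
  have hXY : IndepFun X Y P := h1.comp measurable_id measurable_fst
  have hPX : IsProbabilityMeasure (P.map X) := Measure.isProbabilityMeasure_map hX.aemeasurable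
  have hPY : IsProbabilityMeasure (P.map Y) := Measure.isProbabilityMeasure_map hY.aemeasurable
  have hPZ : IsProbabilityMeasure (P.map Z) := Measure.isProbabilityMeasure_map hZ.aemeasurable
  rw [indepFun_iff_map_prod_eq_prod_map_map (hX.prodMk hY).aemeasurable hZ.aemeasurable,
    (indepFun_iff_map_prod_eq_prod_map_map hX.aemeasurable hY.aemeasurable).1 hXY]
  have h3 := (indepFun_iff_map_prod_eq_prod_map_map hX.aemeasurable
    (hY.prodMk hZ).aemeasurable).1 h1
  rw [(indepFun_iff_map_prod_eq_prod_map_map hY.aemeasurable hZ.aemeasurable).1 h2] at h3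
  have h4 := (measurePreserving_prodAssoc (P.map X) (P.map Y) (P.map Z)).symm.map_eq
  rw [← h4, ← h3, Measure.map_map (MeasurableEquiv.measurable _) (hX.prodMk (hY.prodMk hZ))]
  rfl

/-- A waiting time is independent of the initial positions and any set of other waiting times. -/
theorem AreIndepClocks.indepFun_revealed [IsProbabilityMeasure P] (hy : ∀ i, Measurable (y i))
    (hξ : AreIndepClocks P y ξ) {A : Set (ℤ × ℕ)} {q : ℤ × ℕ} (hq : q ∉ A) :
    IndepFun (revealed y ξ A) (ξ q.1 q.2) P := by
  have hxm : Measurable fun ω (p : ℤ × ℕ) => ξ p.1 p.2 ω :=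
    measurable_pi_lambda _ fun p => hξ.measurable p.1 p.2
  refine indepFun_prodMk_of_indepFun (measurable_pi_lambda _ fun i => hy i)
    ((measurable_indicator_pi A).comp hxm) (hξ.measurable _ _) ?_ ?_
  · exact hξ.indep_init.comp measurable_id
      ((measurable_indicator_pi A).prodMk (measurable_pi_apply q))
  · have hd : Disjoint A {q} := Set.disjoint_singleton_right.2 hq
    have hI := indep_iSup_of_disjoint (fun p : ℤ × ℕ => (hξ.measurable p.1 p.2).comap_le)
      hξ.iIndep.iIndep hd
    rw [IndepFun_iff_Indep]
    refine indep_of_indep_of_le_left (indep_of_indep_of_le_right hI ?_) ?_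
    · exact le_iSup₂_of_le q (Set.mem_singleton q) le_rfl
    · rw [← measurable_iff_comap_le]
      refine @measurable_pi_lambda _ _ _ (_) _ _ fun p => ?_
      by_cases hp : p ∈ A
      · simp only [Set.indicator_of_mem hp]
        refine Measurable.mono (comap_measurable fun ω => ξ p.1 p.2 ω) ?_ le_rfl
        exact le_iSup₂_of_le p hp le_rfl
      · simp only [Set.indicator_of_notMem hp]
        exact measurable_const

theorem AreIndepClocks.ae_pos (hξ : AreIndepClocks P y ξ) :
    ∀ᵐ ω ∂P, ∀ p : ℤ × ℕ, 0 < ξ p.1 p.2 ω := by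
  rw [ae_all_iff]
  intro p
  have h := expMeasure_one_ae_pos
  rw [← (hξ.hasLaw p.1 p.2).map_eq] at h
  exact ae_of_ae_map (hξ.measurable _ _).aemeasurable h

/-- The effective service time of car `k + n` in the queue started at `y k` is exponential and
independent of the initial positions and of all waiting times that are used by cars ahead of it. -/
theorem AreIndepClocks.hasLaw_revealed_serviceTime [IsProbabilityMeasure P]
    (hy : ∀ i, Measurable (y i)) (hξ : AreIndepClocks P y ξ) (n : ℕ) (k : ℤ) :
    HasLaw (fun ω => (revealed y ξ {p | p.1 + p.2 < k + n} ω,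
        serviceTime (fun i => y i ω) (fun p => ξ p.1 p.2 ω) n k))
      ((P.map (revealed y ξ {p | p.1 + p.2 < k + n})).prod (expMeasure 1)) P := by
  have : IsProbabilityMeasure (expMeasure 1) := isProbabilityMeasure_expMeasure one_pos
  have hrm := fun A => measurable_revealed (A := A) hy hξ.measurable
  have hem : Measurable fun ω => ((fun i => y i ω, fun p => ξ p.1 p.2 ω) :
      (ℤ → ℝ) × (ℤ × ℕ → ℝ)) :=
    (measurable_pi_lambda _ fun i => hy i).prodMk
      (measurable_pi_lambda _ fun p => hξ.measurable p.1 p.2)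
  induction n generalizing k with
  | zero =>
    have e : ∀ ω, serviceTime (fun i => y i ω) (fun p => ξ p.1 p.2 ω) 0 k = ξ k 0 ω := by
      intro ω; simp [serviceTime, exitTime, serviceStart]
    simp only [e]
    refine IndepFun.hasLaw_prod ⟨(hrm _).aemeasurable, rfl⟩ (hξ.hasLaw k 0) ?_
    exact hξ.indepFun_revealed hy (q := (k, 0)) (by simp)
  | succ n ih =>
    set A : Set (ℤ × ℕ) := {p | p.1 + p.2 < k + (n + 1 : ℕ)} with hA
    set Z := revealed y ξ A
    have hAeq : {p : ℤ × ℕ | p.1 + p.2 < k + 1 + (n : ℤ)} = A := by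
      ext p; simp only [hA, Set.mem_ofPred_eq]; push_cast; constructor <;> intro h <;> linarith
    have ih' := ih (k + 1)
    rw [hAeq] at ih'
    set U : Ω → ℝ := fun ω => serviceTime (fun i => y i ω) (fun p => ξ p.1 p.2 ω) n (k + 1) with hU
    have hPZ : IsProbabilityMeasure (P.map Z) :=
      Measure.isProbabilityMeasure_map (hrm A).aemeasurable
    have hUm : Measurable U := (measurable_serviceTime n (k + 1)).comp hem
    have hUlaw : HasLaw U (expMeasure 1) P := by
      refine ⟨hUm.aemeasurable, ?_⟩
      have : P.map U = (P.map fun ω => (Z ω, U ω)).map Prod.snd := by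
        rw [Measure.map_map measurable_snd ((hrm A).prodMk hUm)]; rfl
      rw [this, ih'.map_eq, Measure.map_snd_prod, measure_univ, one_smul]
    have hZU : IndepFun Z U P := by
      rw [indepFun_iff_map_prod_eq_prod_map_map (hrm A).aemeasurable hUm.aemeasurable,
        hUlaw.map_eq]
      exact ih'.map_eq
    -- the waiting times revealed by `Z` and `U`
    set B : Set (ℤ × ℕ) := {p | p.1 + p.2 < k + (n + 1 : ℕ) ∨
      k < p.1 ∧ p.1 + p.2 = k + (n + 1 : ℕ)} with hB
    have hZUW : IndepFun (fun ω => (Z ω, U ω)) (ξ k (n + 1)) P := by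
      have h1 := hξ.indepFun_revealed hy (A := B) (q := (k, n + 1)) (by simp [hB])
      have hΦ : Measurable fun e : (ℤ → ℝ) × (ℤ × ℕ → ℝ) =>
          ((e.1, A.indicator e.2), serviceTime e.1 e.2 n (k + 1)) :=
        (measurable_fst.prodMk ((measurable_indicator_pi A).comp measurable_snd)).prodMk
          (measurable_serviceTime n (k + 1))
      have h2 := h1.comp hΦ measurable_id
      refine h2.congr (Eventually.of_forall fun ω => ?_) (Eventually.of_forall fun ω => rfl)
      have hAB : A ⊆ B := fun p hp => Or.inl hp
      simp only [Function.comp_apply, revealed, Z, hU, Set.indicator_indicator,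
        Set.inter_eq_left.2 hAB]
      congr 1
      refine serviceTime_congr n (k + 1) fun p hp1 hp2 => Set.indicator_of_mem ?_ _
      simp only [hB, Set.mem_ofPred_eq]
      push_cast
      omega
    set d : (ℤ → ℝ) × (ℤ × ℕ → ℝ) → ℝ := fun e =>
      max 0 (serviceStart e.1 e.2 (n + 1) k - serviceStart e.1 e.2 n (k + 1)) with hd
    have hdm : Measurable d :=
      measurable_const.max ((measurable_serviceStart _ _).sub (measurable_serviceStart _ _))
    have hres := hasLaw_prod_residual (hrm A) hUm (hξ.measurable k (n + 1)) hdm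
      (fun z => le_max_left _ _) hUlaw (hξ.hasLaw _ _) hZU hZUW
    refine hres.congr ?_
    filter_upwards [hξ.ae_pos] with ω hω
    have hdω : d (Z ω) = serviceStart (fun i => y i ω) (fun p => ξ p.1 p.2 ω) (n + 1) k -
        serviceStart (fun i => y i ω) (fun p => ξ p.1 p.2 ω) n (k + 1) := by
      have h1 : serviceStart (fun i => y i ω) (A.indicator fun p => ξ p.1 p.2 ω) (n + 1) k =
          serviceStart (fun i => y i ω) (fun p => ξ p.1 p.2 ω) (n + 1) k :=
        serviceStart_congr _ _ fun p hp1 hp2 => Set.indicator_of_mem (show p ∈ A from hp2) _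
      have h2 : serviceStart (fun i => y i ω) (A.indicator fun p => ξ p.1 p.2 ω) n (k + 1) =
          serviceStart (fun i => y i ω) (fun p => ξ p.1 p.2 ω) n (k + 1) :=
        serviceStart_congr _ _ fun p hp1 hp2 => Set.indicator_of_mem (hAeq ▸ hp2) _
      simp only [hd, Z, revealed, h1, h2]
      exact max_eq_right (sub_nonneg.2 (serviceStart_succ_left_le hω n k))
    rw [hdω, serviceTime_succ hω n k]

/-- The sums of effective service times have the Laplace transform of a sum of independent
exponential variables. -/
theorem AreIndepClocks.lintegral_exp_sum_serviceTime [IsProbabilityMeasure P]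
    (hy : ∀ i, Measurable (y i)) (hξ : AreIndepClocks P y ξ) {θ : ℝ} (hθ : θ < 1) (k : ℤ)
    (m n : ℕ) (hmn : m ≤ n) :
    ∫⁻ ω, ENNReal.ofReal (Real.exp (θ * ∑ l ∈ Finset.Ico m n,
        serviceTime (fun i => y i ω) (fun p => ξ p.1 p.2 ω) l k)) ∂P =
      ENNReal.ofReal ((1 - θ)⁻¹ ^ (n - m)) := by
  have : IsProbabilityMeasure (expMeasure 1) := isProbabilityMeasure_expMeasure one_pos
  have h1θ : 0 < 1 - θ := by linarith
  have hrm := fun A => measurable_revealed (A := A) hy hξ.measurable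
  induction n, hmn using Nat.le_induction with
  | base => simp
  | succ n hmn ih =>
    set A : Set (ℤ × ℕ) := {p | p.1 + p.2 < k + n} with hA
    set g : (ℤ → ℝ) × (ℤ × ℕ → ℝ) → ℝ≥0∞ := fun e =>
      ENNReal.ofReal (Real.exp (θ * ∑ l ∈ Finset.Ico m n, serviceTime e.1 e.2 l k)) with hg
    have hgm : Measurable g := by
      have : Measurable fun e : (ℤ → ℝ) × (ℤ × ℕ → ℝ) =>
          ∑ l ∈ Finset.Ico m n, serviceTime e.1 e.2 l k :=
        Finset.measurable_sum _ fun l _ => measurable_serviceTime l k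
      fun_prop
    have hgZ : ∀ ω, ENNReal.ofReal (Real.exp (θ * ∑ l ∈ Finset.Ico m n,
        serviceTime (fun i => y i ω) (fun p => ξ p.1 p.2 ω) l k)) = g (revealed y ξ A ω) := by
      intro ω
      simp only [hg, revealed]
      congr 3
      refine Finset.sum_congr rfl fun l hl => serviceTime_congr l k fun p hp1 hp2 => ?_
      rw [Set.indicator_of_mem]
      simp only [hA, Set.mem_ofPred_eq]
      have := (Finset.mem_Ico.1 hl).2
      omega
    have hstep : ∀ ω, ENNReal.ofReal (Real.exp (θ * ∑ l ∈ Finset.Ico m (n + 1),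
        serviceTime (fun i => y i ω) (fun p => ξ p.1 p.2 ω) l k)) = g (revealed y ξ A ω) *
          ENNReal.ofReal (Real.exp (θ *
            serviceTime (fun i => y i ω) (fun p => ξ p.1 p.2 ω) n k)) := by
      intro ω
      rw [← hgZ, ← ENNReal.ofReal_mul (by positivity), ← Real.exp_add, ← mul_add,
        Finset.sum_Ico_succ_top hmn]
    have hlaw := hξ.hasLaw_revealed_serviceTime hy n k
    have hPZ : IsProbabilityMeasure (P.map (revealed y ξ A)) :=
      Measure.isProbabilityMeasure_map (hrm A).aemeasurable
    simp only [hstep]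
    simp only [hgZ] at ih
    have hfm : Measurable fun q : ((ℤ → ℝ) × (ℤ × ℕ → ℝ)) × ℝ =>
      g q.1 * ENNReal.ofReal (Real.exp (θ * q.2)) := by fun_prop
    have h1 := hlaw.lintegral_comp (f := fun q => g q.1 * ENNReal.ofReal (Real.exp (θ * q.2)))
      hfm.aemeasurable
    refine h1.trans ?_
    rw [lintegral_prod_mul (f := g) (g := fun u => ENNReal.ofReal (Real.exp (θ * u)))
        hgm.aemeasurable (by fun_prop), lintegral_exp_mul_expMeasure_one hθ,
      lintegral_map hgm (hrm A), ih, ← ENNReal.ofReal_mul (by positivity),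
      ← pow_succ, Nat.succ_sub hmn]

end Law

/-! ### Large deviations of the service times -/

section Chernoff

variable {Ω : Type*} [MeasurableSpace Ω] {P : Measure Ω} [IsProbabilityMeasure P]
  {y : ℤ → Ω → ℝ} {ξ : ℤ → ℕ → Ω → ℝ}

/-- Chernoff bounds: the upper tail for `θ > 0`, the lower tail for `θ < 0`. -/
theorem AreIndepClocks.measure_mul_le_mul_sum_serviceTime (hy : ∀ i, Measurable (y i))
    (hξ : AreIndepClocks P y ξ) {θ : ℝ} (hθ : θ < 1) (c : ℝ) (k : ℤ) {m n : ℕ} (hmn : m ≤ n) :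
    P {ω | θ * c ≤ θ * ∑ l ∈ Finset.Ico m n,
        serviceTime (fun i => y i ω) (fun p => ξ p.1 p.2 ω) l k} ≤
      ENNReal.ofReal (Real.exp (-(θ * c)) * (1 - θ)⁻¹ ^ (n - m)) := by
  have hem : Measurable fun ω => ((fun i => y i ω, fun p => ξ p.1 p.2 ω) :
      (ℤ → ℝ) × (ℤ × ℕ → ℝ)) :=
    (measurable_pi_lambda _ fun i => hy i).prodMk
      (measurable_pi_lambda _ fun p => hξ.measurable p.1 p.2)
  have hRm : Measurable fun ω => ∑ l ∈ Finset.Ico m n,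
      serviceTime (fun i => y i ω) (fun p => ξ p.1 p.2 ω) l k :=
    Finset.measurable_sum _ fun l _ => (measurable_serviceTime l k).comp hem
  have h1 := meas_ge_le_lintegral_div (μ := P)
    (f := fun ω => ENNReal.ofReal (Real.exp (θ * ∑ l ∈ Finset.Ico m n,
        serviceTime (fun i => y i ω) (fun p => ξ p.1 p.2 ω) l k)))
    (hRm.const_mul θ).exp.ennreal_ofReal.aemeasurable (ε := ENNReal.ofReal (Real.exp (θ * c)))
    (by simp [Real.exp_pos]) ENNReal.ofReal_ne_top
  rw [hξ.lintegral_exp_sum_serviceTime hy hθ k m n hmn,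
    ← ENNReal.ofReal_div_of_pos (Real.exp_pos _)] at h1
  refine (measure_mono fun ω hω => ?_).trans (h1.trans_eq ?_)
  · exact ENNReal.ofReal_le_ofReal (Real.exp_le_exp.2 hω)
  · rw [Real.exp_neg, div_eq_inv_mul]

theorem AreIndepClocks.ae_eventually_sum_serviceTime_le (hy : ∀ i, Measurable (y i))
    (hξ : AreIndepClocks P y ξ) (i : ℤ) {ε : ℝ} (hε : 0 < ε) :
    ∀ᵐ ω ∂P, ∀ᶠ n : ℕ in atTop, ∀ m ≤ n, ∑ l ∈ Finset.Ico m (n + 1),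
      serviceTime (fun i => y i ω) (fun p => ξ p.1 p.2 ω) l (i - n) ≤
        (1 + ε) * ((n + 1 - m : ℕ) : ℝ) + ε * n := by
  -- this `θ` maximizes `θ (1 + ε) + log (1 - θ)`
  set θ := ε / (1 + ε) with hθdef
  have hθ0 : 0 < θ := by positivity
  have hθ1 : θ < 1 := by rw [hθdef, div_lt_one (by linarith)]; linarith
  have hθε : θ * (1 + ε) = ε := div_mul_cancel₀ _ (by linarith)
  have hinv : (1 - θ)⁻¹ = 1 + ε := by rw [hθdef]; field_simp; ring
  set r := Real.exp (-(θ * ε)) with hr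
  have hr1 : r < 1 := by rw [hr, Real.exp_lt_one_iff]; nlinarith
  have hr0 : 0 < r := Real.exp_pos _
  have hbound : ∀ (n m : ℕ), m ≤ n → P {ω | (1 + ε) * ((n + 1 - m : ℕ) : ℝ) + ε * n ≤
      ∑ l ∈ Finset.Ico m (n + 1),
        serviceTime (fun i => y i ω) (fun p => ξ p.1 p.2 ω) l (i - n)} ≤
      ENNReal.ofReal (r ^ n) := by
    intro n m hmn
    refine (measure_mono fun ω hω => ?_).trans ((hξ.measure_mul_le_mul_sum_serviceTime hy hθ1
      ((1 + ε) * ((n + 1 - m : ℕ) : ℝ) + ε * n) (i - n) (show m ≤ n + 1 by omega)).trans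
      (ENNReal.ofReal_le_ofReal ?_))
    · exact mul_le_mul_of_nonneg_left hω hθ0.le
    · have e : Real.exp (-(θ * ((1 + ε) * ((n + 1 - m : ℕ) : ℝ) + ε * n))) =
          Real.exp (-ε) ^ (n + 1 - m) * r ^ n := by
        rw [hr, ← Real.exp_nat_mul, ← Real.exp_nat_mul, ← Real.exp_add, mul_add, ← mul_assoc, hθε]
        congr 1; ring
      rw [e, hinv, mul_right_comm, ← mul_pow]
      refine mul_le_of_le_one_left (by positivity) (pow_le_one₀ (by positivity) ?_)
      rw [Real.exp_neg, inv_mul_le_one₀ (Real.exp_pos _)]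
      linarith [Real.add_one_le_exp ε]
  have hsum : Summable fun n : ℕ => ((n : ℝ) + 1) * r ^ n := by
    have h1 := summable_pow_mul_geometric_of_norm_lt_one (R := ℝ) 1 (r := r)
      (by rwa [Real.norm_of_nonneg hr0.le])
    have h2 := summable_geometric_of_lt_one hr0.le hr1
    refine (h1.add h2).congr fun n => ?_
    ring
  have hmeas : ∀ n : ℕ, P {ω | ∃ m ≤ n, (1 + ε) * ((n + 1 - m : ℕ) : ℝ) + ε * n ≤
      ∑ l ∈ Finset.Ico m (n + 1),
        serviceTime (fun i => y i ω) (fun p => ξ p.1 p.2 ω) l (i - n)} ≤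
      ENNReal.ofReal (((n : ℝ) + 1) * r ^ n) := by
    intro n
    have hsub : {ω | ∃ m ≤ n, (1 + ε) * ((n + 1 - m : ℕ) : ℝ) + ε * n ≤
        ∑ l ∈ Finset.Ico m (n + 1),
          serviceTime (fun i => y i ω) (fun p => ξ p.1 p.2 ω) l (i - n)} ⊆
        ⋃ m ∈ Finset.range (n + 1), {ω | (1 + ε) * ((n + 1 - m : ℕ) : ℝ) + ε * n ≤
          ∑ l ∈ Finset.Ico m (n + 1),
            serviceTime (fun i => y i ω) (fun p => ξ p.1 p.2 ω) l (i - n)} := by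
      rintro ω ⟨m, hm, h⟩
      exact Set.mem_biUnion (Finset.mem_coe.2 (Finset.mem_range.2 (by omega))) h
    refine (measure_mono hsub).trans ((measure_biUnion_finset_le _ _).trans ?_)
    refine (Finset.sum_le_sum fun m hm =>
      hbound n m (by have := Finset.mem_range.1 hm; omega)).trans_eq ?_
    rw [Finset.sum_const, Finset.card_range, nsmul_eq_mul, ENNReal.ofReal_mul (by positivity)]
    congr 1
    exact_mod_cast (ENNReal.ofReal_natCast (n + 1)).symm
  have hfin : ∑' n : ℕ, P {ω | ∃ m ≤ n, (1 + ε) * ((n + 1 - m : ℕ) : ℝ) + ε * n ≤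
      ∑ l ∈ Finset.Ico m (n + 1),
        serviceTime (fun i => y i ω) (fun p => ξ p.1 p.2 ω) l (i - n)} ≠ ∞ :=
    ne_top_of_le_ne_top hsum.tsum_ofReal_ne_top (ENNReal.tsum_le_tsum hmeas)
  filter_upwards [ae_eventually_notMem hfin] with ω hω
  filter_upwards [hω] with n hn m hm
  by_contra hcon
  exact hn ⟨m, hm, (not_le.1 hcon).le⟩

theorem AreIndepClocks.ae_eventually_le_sum_serviceTime (hy : ∀ i, Measurable (y i))
    (hξ : AreIndepClocks P y ξ) (i : ℤ) {ε : ℝ} (hε : 0 < ε) :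
    ∀ᵐ ω ∂P, ∀ᶠ n : ℕ in atTop, (1 - ε) * ((n + 1 : ℕ) : ℝ) ≤ ∑ l ∈ Finset.Ico 0 (n + 1),
      serviceTime (fun i => y i ω) (fun p => ξ p.1 p.2 ω) l (i - n) := by
  set r := Real.exp (ε * (1 - ε)) * (1 + ε)⁻¹ with hr
  have hr0 : 0 < r := by positivity
  have hr1 : r < 1 := by
    -- `exp x * (1 - x) ≤ 1` for `x = ε (1 - ε)`, and `(1 - x) (1 + ε) = 1 + ε ^ 3`
    rw [hr, mul_inv_lt_iff₀ (by linarith), one_mul]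
    have h1 : 1 - ε * (1 - ε) ≤ Real.exp (-(ε * (1 - ε))) := by
      linarith [Real.add_one_le_exp (-(ε * (1 - ε)))]
    have h2 : Real.exp (ε * (1 - ε)) * Real.exp (-(ε * (1 - ε))) = 1 := by
      rw [← Real.exp_add]; simp
    have h3 : 0 < Real.exp (ε * (1 - ε)) := Real.exp_pos _
    have h4 : Real.exp (ε * (1 - ε)) * (1 - ε * (1 - ε)) ≤ 1 :=
      (mul_le_mul_of_nonneg_left h1 h3.le).trans_eq h2
    have h5 : 0 < 1 - ε * (1 - ε) := by nlinarith [sq_nonneg (ε - 1 / 2)]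
    have h6 : (1 + ε) * (1 - ε * (1 - ε)) = 1 + ε ^ 3 := by ring
    have h7 : 0 < ε ^ 3 := by positivity
    by_contra hcon
    have := mul_le_mul_of_nonneg_right (not_lt.1 hcon) h5.le
    linarith
  have hmeas : ∀ n : ℕ, P {ω | ∑ l ∈ Finset.Ico 0 (n + 1),
      serviceTime (fun i => y i ω) (fun p => ξ p.1 p.2 ω) l (i - n) ≤
        (1 - ε) * ((n + 1 : ℕ) : ℝ)} ≤ ENNReal.ofReal (r ^ (n + 1)) := by
    intro n
    refine (measure_mono fun ω hω => ?_).trans ((hξ.measure_mul_le_mul_sum_serviceTime hy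
      (θ := -ε) (by linarith) ((1 - ε) * ((n + 1 : ℕ) : ℝ)) (i - n)
      (Nat.zero_le (n + 1))).trans_eq ?_)
    · exact mul_le_mul_of_nonpos_left hω (neg_nonpos.2 hε.le)
    · rw [hr, mul_pow, ← Real.exp_nat_mul, sub_neg_eq_add, Nat.sub_zero]
      congr 3; ring
  have hsum : Summable fun n : ℕ => r ^ (n + 1) :=
    (summable_nat_add_iff 1).2 (summable_geometric_of_lt_one hr0.le hr1)
  have hfin := ne_top_of_le_ne_top hsum.tsum_ofReal_ne_top (ENNReal.tsum_le_tsum hmeas)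
  filter_upwards [ae_eventually_notMem hfin] with ω hω
  filter_upwards [hω] with n hn
  exact (not_le.1 hn).le

end Chernoff

/-! ### The density of the initial positions -/

theorem hasSum_poissonMeasure_mul (r : NNReal) :
    HasSum (fun n : ℕ => Real.exp (-r) * r ^ n / n.factorial * (n : ℝ)) r := by
  rw [← hasSum_nat_add_iff' 1]
  have h := (hasSum_one_poissonMeasure r).mul_left (r : ℝ)
  have e : (fun n : ℕ =>
      Real.exp (-r) * (r : ℝ) ^ (n + 1) / (n + 1).factorial * ((n + 1 : ℕ) : ℝ)) =
      fun n => (r : ℝ) * (Real.exp (-r) * r ^ n / n.factorial) := by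
    funext n
    rw [Nat.factorial_succ]
    push_cast
    have := n.factorial_ne_zero
    field_simp
    ring
  rw [e]
  simpa using h

theorem integrable_natCast_poissonMeasure (r : NNReal) :
    Integrable (fun n : ℕ => (n : ℝ)) (poissonMeasure r) := by
  rw [integrable_poissonMeasure_iff]
  simpa using (hasSum_poissonMeasure_mul r).summable

theorem integral_natCast_poissonMeasure (r : NNReal) :
    ∫ n, (n : ℝ) ∂(poissonMeasure r) = r := by
  rw [integral_poissonMeasure]
  simpa using (hasSum_poissonMeasure_mul r).tsum_eq

/-- If the number `N m` of points in `(-m, 0]` grows like `c * m`, then the `n`-th point to the left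
of the origin is near `-n / c`. -/
theorem tendsto_div_of_counting {a : ℕ → ℝ} {N : ℕ → ℕ} {c : ℝ} (hc : 0 < c)
    (ha : ∀ n, a n ≤ 0) (hmono : Monotone N) (hN : ∀ n m : ℕ, -(m : ℝ) < a n ↔ n + 1 ≤ N m)
    (hlim : Tendsto (fun m : ℕ => (N m : ℝ) / m) atTop (𝓝 c)) :
    Tendsto (fun n : ℕ => a n / n) atTop (𝓝 (-(1 / c))) := by
  set m : ℕ → ℕ := fun n => ⌊-a n⌋₊ with hm
  have h1 : ∀ n, (m n : ℝ) ≤ -a n := fun n => Nat.floor_le (neg_nonneg.2 (ha n))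
  have h2 : ∀ n, -a n < m n + 1 := fun n => Nat.lt_floor_add_one _
  have h3 : ∀ n, N (m n) ≤ n := by
    intro n
    by_contra hcon
    have := (hN n (m n)).2 (by omega)
    linarith [h1 n]
  have h4 : ∀ n, n + 1 ≤ N (m n + 1) := fun n => by
    rw [← hN]; push_cast; linarith [h2 n]
  have hmtop : Tendsto m atTop atTop := by
    rw [tendsto_atTop]
    intro M
    filter_upwards [eventually_ge_atTop (N M)] with n hn
    by_contra hcon
    have := hmono (show m n + 1 ≤ M by omega)
    have := h4 n
    omega
  have hmpos : ∀ᶠ n in atTop, 0 < (m n : ℝ) := by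
    filter_upwards [hmtop.eventually_gt_atTop 0] with n hn
    exact_mod_cast hn
  have hmR : Tendsto (fun n => (m n : ℝ)) atTop atTop := tendsto_natCast_atTop_atTop.comp hmtop
  have hinv : Tendsto (fun n => 1 / (m n : ℝ)) atTop (𝓝 0) :=
    tendsto_const_nhds.div_atTop hmR
  have hratio : Tendsto (fun n : ℕ => (n : ℝ) / m n) atTop (𝓝 c) := by
    have hl : Tendsto (fun n => (N (m n) : ℝ) / m n) atTop (𝓝 c) := hlim.comp hmtop
    have hu : Tendsto (fun n => (N (m n + 1) : ℝ) / ((m n + 1 : ℕ) : ℝ) * (1 + 1 / (m n : ℝ)))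
        atTop (𝓝 c) := by
      have h5 : Tendsto (fun n => (N (m n + 1) : ℝ) / ((m n + 1 : ℕ) : ℝ)) atTop (𝓝 c) :=
        hlim.comp ((tendsto_add_atTop_nat 1).comp hmtop)
      simpa using h5.mul (hinv.const_add 1)
    refine tendsto_of_tendsto_of_tendsto_of_le_of_le' hl hu ?_ ?_
    · filter_upwards [hmpos] with n hn
      have : (N (m n) : ℝ) ≤ n := by exact_mod_cast h3 n
      gcongr
    · filter_upwards [hmpos] with n hn
      have h5 : (n : ℝ) ≤ N (m n + 1) := by exact_mod_cast (Nat.le_succ n).trans (h4 n)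
      have h6 : (N (m n + 1) : ℝ) / ((m n + 1 : ℕ) : ℝ) * (1 + 1 / (m n : ℝ)) =
          N (m n + 1) / m n := by
        push_cast; field_simp
      rw [h6]
      gcongr
  have hone : Tendsto (fun n => -a n / m n) atTop (𝓝 1) := by
    refine tendsto_of_tendsto_of_tendsto_of_le_of_le' tendsto_const_nhds
      (show Tendsto (fun n => 1 + 1 / (m n : ℝ)) atTop (𝓝 1) by simpa using hinv.const_add 1) ?_ ?_
    · filter_upwards [hmpos] with n hn
      rw [le_div_iff₀ hn, one_mul]; exact h1 n
    · filter_upwards [hmpos] with n hn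
      rw [div_le_iff₀ hn]; field_simp; exact (h2 n).le
  have := (hone.div hratio hc.ne').neg
  refine this.congr' ?_
  filter_upwards [hmpos] with n hn
  simp only [Pi.div_apply]
  rw [div_div_div_cancel_right₀ hn.ne']; ring

section Labelled

variable {Ω : Type*} [MeasurableSpace Ω] {P : Measure Ω}

/-- The strong law of large numbers for the number of points in `(-m, 0]`. -/
theorem IsPoissonProcess.ae_tendsto_count {lam : ℝ} (hlam : 0 < lam) {X : Ω → Set ℝ}
    (hX : IsPoissonProcess P lam X) :
    ∀ᵐ ω ∂P, (∀ r : ℕ, (X ω ∩ Set.Ioc (-(r + 1 : ℝ)) (-(r : ℝ))).encard ≠ ⊤) ∧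
      Tendsto (fun m : ℕ => ((∑ r ∈ Finset.range m,
        (X ω ∩ Set.Ioc (-(r + 1 : ℝ)) (-(r : ℝ))).encard.toNat : ℕ) : ℝ) / m) atTop (𝓝 lam) := by
  set B : ℕ → Set ℝ := fun r => Set.Ioc (-(r + 1 : ℝ)) (-(r : ℝ)) with hB
  have hvol : ∀ r, volume (B r) = 1 := by
    intro r; simp only [hB, Real.volume_Ioc]; norm_num
  have hlaw : ∀ r, HasLaw (fun ω => (X ω ∩ B r).encard)
      ((poissonMeasure lam.toNNReal).map (fun n : ℕ => (n : ℕ∞))) P := by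
    intro r
    have := hX.hasLaw_count (B r) measurableSet_Ioc (by rw [hvol]; simp)
    simpa [hvol] using this
  have hdisj : ∀ r s, r ≠ s → Disjoint (B r) (B s) := by
    intro r s hrs
    rw [Set.disjoint_left]
    rintro u ⟨h1, h2⟩ ⟨h3, h4⟩
    rcases lt_or_gt_of_ne hrs with h | h
    · have : (r : ℝ) + 1 ≤ s := by exact_mod_cast h
      linarith
    · have : (s : ℝ) + 1 ≤ r := by exact_mod_cast h
      linarith
  have hfinite : ∀ᵐ ω ∂P, ∀ r, (X ω ∩ B r).encard ≠ ⊤ := by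
    rw [ae_all_iff]
    intro r
    refine ((hlaw r).ae_iff (p := fun u => u ≠ ⊤) ?_).2 ?_
    · exact Measurable.of_discrete
    · rw [ae_map_iff (by fun_prop) (.of_discrete)]
      simp
  set g : ℕ∞ → ℝ := fun u => (u.toNat : ℝ) with hg
  have hgm : Measurable g := Measurable.of_discrete
  have hlaw' : ∀ r, HasLaw (fun ω => g (X ω ∩ B r).encard)
      ((poissonMeasure lam.toNNReal).map (fun n : ℕ => (n : ℝ))) P := by
    intro r
    refine ⟨hgm.comp_aemeasurable (hlaw r).aemeasurable, ?_⟩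
    have : (fun ω => g (X ω ∩ B r).encard) = g ∘ fun ω => (X ω ∩ B r).encard := rfl
    rw [this, ← AEMeasurable.map_map_of_aemeasurable hgm.aemeasurable (hlaw r).aemeasurable,
      (hlaw r).map_eq, Measure.map_map hgm .of_discrete]
    rfl
  have hint : Integrable (fun ω => g (X ω ∩ B 0).encard) P := by
    have h := (integrable_natCast_poissonMeasure lam.toNNReal)
    have h2 : Integrable id ((poissonMeasure lam.toNNReal).map (fun n : ℕ => (n : ℝ))) :=
      (integrable_map_measure (by fun_prop) (.of_discrete)).2 h
    rw [← (hlaw' 0).map_eq] at h2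
    exact (integrable_map_measure (by fun_prop) (hlaw' 0).aemeasurable).1 h2
  have hmean : ∫ ω, g (X ω ∩ B 0).encard ∂P = lam := by
    rw [(hlaw' 0).integral_eq, integral_map .of_discrete (by fun_prop),
      integral_natCast_poissonMeasure, Real.coe_toNNReal _ hlam.le]
  have hindep : Pairwise fun r s => IndepFun (fun ω => g (X ω ∩ B r).encard)
      (fun ω => g (X ω ∩ B s).encard) P := by
    intro r s hrs
    have h := hX.indep_count 2 ![B r, B s] (by
      intro k; fin_cases k <;> exact measurableSet_Ioc) (by
      intro k l hkl
      fin_cases k <;> fin_cases l <;> simp at hkl ⊢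
      · exact hdisj r s hrs
      · exact hdisj s r hrs.symm)
    exact (h.indepFun (show (0 : Fin 2) ≠ 1 by decide)).comp hgm hgm
  have hslln := strong_law_ae_real (fun r ω => g (X ω ∩ B r).encard) hint hindep
    fun r => ⟨(hlaw' r).aemeasurable, (hlaw' 0).aemeasurable, by
      rw [(hlaw' r).map_eq, (hlaw' 0).map_eq]⟩
  filter_upwards [hfinite, hslln] with ω h1 h2
  refine ⟨h1, ?_⟩
  rw [hmean] at h2
  refine h2.congr fun m => ?_
  simp only [hg, hB, Nat.cast_sum]

/-- The `n`-th point to the left of the origin lies in `(-m, 0]` if and only if there are at least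
`n + 1` points in `(-m, 0]`. Finiteness of the counts matters, as `ENat.toNat` sends `⊤` to 0. -/
theorem StrictMono.lt_apply_neg_iff_le_sum_encard {y : ℤ → ℝ} (hy : StrictMono y)
    (h0 : y 0 ≤ 0) (h1 : 0 < y 1)
    (hfin : ∀ r : ℕ, (Set.range y ∩ Set.Ioc (-(r + 1 : ℝ)) (-(r : ℝ))).encard ≠ ⊤) (n m : ℕ) :
    -(m : ℝ) < y (-n) ↔ n + 1 ≤ ∑ r ∈ Finset.range m,
      (Set.range y ∩ Set.Ioc (-(r + 1 : ℝ)) (-(r : ℝ))).encard.toNat := by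
  have hsum : ((∑ r ∈ Finset.range m,
      (Set.range y ∩ Set.Ioc (-(r + 1 : ℝ)) (-(r : ℝ))).encard.toNat : ℕ) : ℕ∞) =
      (Set.range y ∩ Set.Ioc (-(m : ℝ)) 0).encard := by
    induction m with
    | zero => simp
    | succ m ih =>
      rw [Finset.sum_range_succ, Nat.cast_add, ih, ENat.natCast_toNat (hfin m),
        ← Set.encard_union_eq]
      · rw [← Set.inter_union_distrib_left, Set.union_comm, Set.Ioc_union_Ioc_eq_Ioc]
        · push_cast; rfl
        · linarith
        · simp
      · refine Set.disjoint_left.2 ?_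
        rintro u ⟨_, h1, _⟩ ⟨_, _, h3⟩
        linarith
  have hcard : ∀ j : ℕ, (y '' Set.Ioc (-(j : ℤ)) 0).encard = j := by
    intro j
    rw [hy.injective.encard_image, ← Finset.coe_Ioc, Set.encard_coe_eq_coe_finsetCard]
    simp
  rw [← Nat.cast_le (α := ℕ∞), hsum]
  constructor
  · intro h
    rw [← hcard (n + 1)]
    refine Set.encard_le_encard ?_
    rintro _ ⟨j, hj, rfl⟩
    refine ⟨⟨j, rfl⟩, h.trans_le (hy.monotone ?_), (hy.monotone hj.2).trans h0⟩
    have := hj.1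
    push_cast at this
    omega
  · intro h
    by_contra hcon
    have hle : (Set.range y ∩ Set.Ioc (-(m : ℝ)) 0).encard ≤ n := by
      rw [← hcard n]
      refine Set.encard_le_encard ?_
      rintro _ ⟨⟨j, rfl⟩, hj1, hj2⟩
      refine ⟨j, ⟨hy.lt_iff_lt.1 ((not_lt.1 hcon).trans_lt hj1), ?_⟩, rfl⟩
      have := hy.lt_iff_lt.1 (hj2.trans_lt h1)
      omega
    have := h.trans hle
    norm_cast at this
    omega

theorem IsLabelledPoisson.ae_tendsto_div {lam : ℝ} (hlam : 0 < lam) {y : ℤ → Ω → ℝ}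
    (hy : IsLabelledPoisson P lam y) (i : ℤ) :
    ∀ᵐ ω ∂P, Tendsto (fun n : ℕ => y (i - n) ω / n) atTop (𝓝 (-(1 / lam))) := by
  filter_upwards [hy.poisson.ae_tendsto_count hlam, hy.strictMono, hy.label] with ω h1 h2 h3
  have hmain : Tendsto (fun n : ℕ => y (-n) ω / n) atTop (𝓝 (-(1 / lam))) := by
    refine tendsto_div_of_counting hlam (fun n => (h2.monotone (by simp)).trans h3.1) ?_
      (h2.lt_apply_neg_iff_le_sum_encard h3.1 h3.2 h1.1) h1.2
    intro a b hab
    exact Finset.sum_le_sum_of_subset (Finset.range_mono hab)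
  set m : ℕ → ℕ := fun n => (n - i).toNat with hm
  have hmi : ∀ᶠ n : ℕ in atTop, (m n : ℤ) = n - i := by
    filter_upwards [eventually_ge_atTop i.toNat] with n hn
    simp only [hm]
    omega
  have hmtop : Tendsto m atTop atTop := by
    rw [tendsto_atTop]
    intro M
    filter_upwards [eventually_ge_atTop (M + i.toNat)] with n hn
    simp only [hm]
    omega
  have hratio : Tendsto (fun n : ℕ => (m n : ℝ) / n) atTop (𝓝 1) := by
    have h4 : Tendsto (fun n : ℕ => 1 - (i : ℝ) / n) atTop (𝓝 1) := by
      simpa using (tendsto_const_nhds.div_atTop tendsto_natCast_atTop_atTop :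
        Tendsto (fun n : ℕ => (i : ℝ) / n) atTop (𝓝 0)).const_sub 1
    refine h4.congr' ?_
    filter_upwards [hmi, eventually_gt_atTop 0] with n hn hn0
    have hn' : (m n : ℝ) = n - i := by exact_mod_cast hn
    have hn0' : (n : ℝ) ≠ 0 := by exact_mod_cast hn0.ne'
    rw [hn']; field_simp
  have := (hmain.comp hmtop).mul hratio
  rw [mul_one] at this
  refine this.congr' ?_
  filter_upwards [hmi, hmtop.eventually_gt_atTop 0] with n hn hn0
  have e : -(m n : ℤ) = i - n := by omega
  have hn0' : (m n : ℝ) ≠ 0 := by exact_mod_cast hn0.ne'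
  simp only [Function.comp_apply, e]
  field_simp

end Labelled

/-! ### The mean velocity -/

/-- A monotone function that is sampled at times `T n ~ a * n` and behaves like `b * n` there,
behaves like `(b / a) * t`. -/
theorem tendsto_div_of_monotoneOn_of_sampled {g : ℝ → ℝ} (hg : MonotoneOn g (Set.Ici 0))
    {T : ℕ → ℝ} (hT : ∀ n, 0 ≤ T n) {a b : ℝ} (ha : 0 < a) (hb : 0 < b)
    (hTlim : Tendsto (fun n : ℕ => T n / n) atTop (𝓝 a))
    (hglim : Tendsto (fun n : ℕ => g (T n) / n) atTop (𝓝 b)) :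
    Tendsto (fun t => g t / t) atTop (𝓝 (b / a)) := by
  have hTtop : Tendsto T atTop atTop := by
    have h1 := hTlim.pos_mul_atTop ha tendsto_natCast_atTop_atTop
    refine h1.congr' ?_
    filter_upwards [eventually_gt_atTop 0] with n hn
    have : (n : ℝ) ≠ 0 := by exact_mod_cast hn.ne'
    field_simp
  have hex : ∀ t, ∃ n, t < T (n + 1) := fun t =>
    ((hTtop.comp (tendsto_add_atTop_nat 1)).eventually_gt_atTop t).exists
  classical
  set N : ℝ → ℕ := fun t => Nat.find (hex t) with hN
  have hN1 : ∀ t, t < T (N t + 1) := fun t => Nat.find_spec (hex t)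
  have hN2 : ∀ t, T 0 ≤ t → T (N t) ≤ t := by
    intro t ht
    rcases Nat.eq_zero_or_pos (N t) with h | h
    · rw [h]; exact ht
    · have := Nat.find_min (hex t) (show N t - 1 < N t by omega)
      rw [not_lt, Nat.sub_add_cancel h] at this
      exact this
  have hNtop : Tendsto N atTop atTop := by
    rw [tendsto_atTop]
    intro M
    filter_upwards [(Finset.range (M + 1)).eventually_all.2 fun j _ => eventually_ge_atTop (T j)]
      with t ht
    by_contra hcon
    exact absurd (hN1 t) (not_lt.2 (ht (N t + 1) (Finset.mem_range.2 (by omega))))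
  have hsucc : Tendsto (fun n : ℕ => ((n + 1 : ℕ) : ℝ) / n) atTop (𝓝 1) := by
    have h1 : Tendsto (fun n : ℕ => 1 + 1 / (n : ℝ)) atTop (𝓝 1) := by
      simpa using (tendsto_one_div_atTop_nhds_zero_nat (𝕜 := ℝ)).const_add 1
    refine h1.congr' ?_
    filter_upwards [eventually_gt_atTop 0] with n hn
    have : (n : ℝ) ≠ 0 := by exact_mod_cast hn.ne'
    push_cast; field_simp
  have hT1 : Tendsto (fun n : ℕ => T (n + 1) / n) atTop (𝓝 a) := by
    have h1 := (hTlim.comp (tendsto_add_atTop_nat 1)).mul hsucc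
    rw [mul_one] at h1
    refine h1.congr fun n => ?_
    have : ((n + 1 : ℕ) : ℝ) ≠ 0 := by positivity
    simp only [Function.comp_apply]
    field_simp
  have hg1 : Tendsto (fun n : ℕ => g (T (n + 1)) / n) atTop (𝓝 b) := by
    have h1 := (hglim.comp (tendsto_add_atTop_nat 1)).mul hsucc
    rw [mul_one] at h1
    refine h1.congr fun n => ?_
    have : ((n + 1 : ℕ) : ℝ) ≠ 0 := by positivity
    simp only [Function.comp_apply]
    field_simp
  have hl : Tendsto (fun n => g (T n) / T (n + 1)) atTop (𝓝 (b / a)) := by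
    refine (hglim.div hT1 ha.ne').congr' ?_
    filter_upwards [eventually_gt_atTop 0] with n hn
    have : (n : ℝ) ≠ 0 := by exact_mod_cast hn.ne'
    exact div_div_div_cancel_right₀ this _ _
  have hu : Tendsto (fun n => g (T (n + 1)) / T n) atTop (𝓝 (b / a)) := by
    refine (hg1.div hTlim ha.ne').congr' ?_
    filter_upwards [eventually_gt_atTop 0] with n hn
    have : (n : ℝ) ≠ 0 := by exact_mod_cast hn.ne'
    exact div_div_div_cancel_right₀ this _ _
  have hgpos : ∀ᶠ n : ℕ in atTop, 0 < g (T n) := by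
    filter_upwards [hglim.eventually_const_lt hb] with n hn
    by_contra hcon
    exact absurd hn (not_lt.2 (div_nonpos_of_nonpos_of_nonneg (not_lt.1 hcon) n.cast_nonneg))
  refine tendsto_of_tendsto_of_tendsto_of_le_of_le' (hl.comp hNtop) (hu.comp hNtop) ?_ ?_
  all_goals
    filter_upwards [eventually_gt_atTop 0, eventually_ge_atTop (T 0), hNtop.eventually hgpos,
      hNtop.eventually ((tendsto_add_atTop_nat 1).eventually hgpos),
      hNtop.eventually (hTtop.eventually_gt_atTop 0)] with t ht ht0 hgt hgt1 hTt
    simp only [Function.comp_apply]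
  · exact div_le_div₀ (hgt.le.trans (hg (hT _) ht.le (hN2 t ht0)))
      (hg (hT _) ht.le (hN2 t ht0)) ht (hN1 t).le
  · exact div_le_div₀ hgt1.le (hg ht.le (hT _) (hN1 t).le) hTt (hN2 t ht0)

/-- The order of growth of the exit times, from the law of large numbers for the initial positions
and the large deviation bounds for the service times. -/
theorem tendsto_exitTime_div {lam : ℝ} {y : ℤ → ℝ} {x : ℤ × ℕ → ℝ}
    (hx : ∀ p, 0 < x p) (i : ℤ)
    (hy : Tendsto (fun n : ℕ => y (i - n) / n) atTop (𝓝 (-(1 / lam))))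
    (hupper : ∀ ε > 0, ∃ ε' > 0, ε' ≤ ε ∧ ∀ᶠ n : ℕ in atTop, ∀ m ≤ n,
      ∑ l ∈ Finset.Ico m (n + 1), serviceTime y x l (i - n) ≤
        (1 + ε') * ((n + 1 - m : ℕ) : ℝ) + ε' * n)
    (hlower : ∀ ε > 0, ∃ ε' > 0, ε' ≤ ε ∧ ∀ᶠ n : ℕ in atTop,
      (1 - ε') * ((n + 1 : ℕ) : ℝ) ≤
        ∑ l ∈ Finset.Ico 0 (n + 1), serviceTime y x l (i - n)) :
    Tendsto (fun n : ℕ => exitTime y x n (i - n) / n) atTop (𝓝 (max (1 - 1 / lam) 0)) := by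
  have hnz : Tendsto (fun n : ℕ => (n : ℝ)) atTop atTop := tendsto_natCast_atTop_atTop
  rw [tendsto_order]
  constructor
  · intro c hc
    rcases lt_max_iff.1 hc with hc | hc
    · obtain ⟨ε, hε, hεc⟩ : ∃ ε > 0, c < 1 - 1 / lam - 2 * ε :=
        ⟨(1 - 1 / lam - c) / 4, by linarith, by linarith⟩
      obtain ⟨ε', hε', hεε', hlow⟩ := hlower (min ε 1) (lt_min hε one_pos)
      filter_upwards [hlow, hy.eventually_const_lt (show -(1 / lam) - ε < -(1 / lam) by linarith),
        eventually_gt_atTop 0] with n hn hyn hn0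
      have hn0' : (0 : ℝ) < n := by exact_mod_cast hn0
      rw [lt_div_iff₀ hn0'] at hyn ⊢
      have h1 := add_sum_serviceTime_le_exitTime (y := y) (x := x) n (i - n)
      have h2 : (1 - ε') * (n : ℝ) ≤ (1 - ε') * ((n + 1 : ℕ) : ℝ) := by
        refine mul_le_mul_of_nonneg_left (by push_cast; linarith) ?_
        linarith [min_le_right ε 1]
      have h3 : (1 - ε) * (n : ℝ) ≤ (1 - ε') * n :=
        mul_le_mul_of_nonneg_right (by linarith [min_le_left ε 1]) hn0'.le
      have h4 := mul_lt_mul_of_pos_right hεc hn0'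
      linarith
    · -- car `i` does not reach `y (i - n)` before it would reach it without stopping
      have h0 : Tendsto (fun n : ℕ => y i / (n : ℝ)) atTop (𝓝 0) :=
        tendsto_const_nhds.div_atTop hnz
      filter_upwards [h0.eventually_const_lt hc] with n hn
      refine hn.trans_le ?_
      have h1 := init_le_exitTime (y := y) hx n (i - n)
      rw [sub_add_cancel] at h1
      gcongr
  · intro c hc
    set M := max (1 - 1 / lam) 0 with hM
    have hM0 : 0 ≤ M := le_max_right _ _
    have hM1 : 1 - 1 / lam ≤ M := le_max_left _ _
    obtain ⟨ε, hε, hεc⟩ : ∃ ε > 0, M + 4 * ε < c := ⟨(c - M) / 8, by linarith, by linarith⟩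
    obtain ⟨ε', hε', hεε', hup⟩ := hupper ε hε
    -- a bound for all initial positions to the left of car `i`
    obtain ⟨K, hK⟩ : ∃ K : ℝ, ∀ j : ℕ, y (i - j) ≤ (-(1 / lam) + ε) * j + K := by
      obtain ⟨j₀, hj₀⟩ := eventually_atTop.1
        ((hy.eventually_lt_const (show -(1 / lam) < -(1 / lam) + ε by linarith)).and
          (eventually_gt_atTop 0))
      refine ⟨∑ j ∈ Finset.range j₀, |y (i - j) - (-(1 / lam) + ε) * j|, fun j => ?_⟩
      have hsum : ∀ s : Finset ℕ, 0 ≤ ∑ j ∈ s, |y (i - j) - (-(1 / lam) + ε) * j| :=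
        fun s => Finset.sum_nonneg fun _ _ => abs_nonneg _
      rcases le_or_gt j₀ j with h | h
      · have h1 := hj₀ j h
        rw [div_lt_iff₀ (by exact_mod_cast h1.2)] at h1
        linarith [hsum (Finset.range j₀), h1.1]
      · have h1 := Finset.single_le_sum (f := fun j : ℕ => |y (i - j) - (-(1 / lam) + ε) * j|)
          (fun _ _ => abs_nonneg _) (Finset.mem_range.2 h)
        have h2 := le_abs_self (y (i - j) - (-(1 / lam) + ε) * j)
        linarith
    have hrest : Tendsto (fun n : ℕ => (K + 1 + ε) / (n : ℝ)) atTop (𝓝 0) :=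
      tendsto_const_nhds.div_atTop hnz
    filter_upwards [hup, hrest.eventually_lt_const hε, eventually_gt_atTop 0] with n hn hKn hn0
    have hn0' : (0 : ℝ) < n := by exact_mod_cast hn0
    rw [div_lt_iff₀ hn0'] at hKn ⊢
    have hle : exitTime y x n (i - n) ≤ (M + 3 * ε) * n + (K + 1 + ε) := by
      refine exitTime_le_of_forall n (i - n) _ fun m hm => ?_
      have h1 := hn m hm
      obtain ⟨j, rfl⟩ := Nat.exists_eq_add_of_le hm
      have e1 : i - ((m + j : ℕ) : ℤ) + m = i - j := by push_cast; ring
      have e2 : m + j + 1 - m = j + 1 := by omega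
      rw [e2] at h1
      rw [e1]
      have h2 := hK j
      have hj : (j : ℝ) ≤ ((m + j : ℕ) : ℝ) := by exact_mod_cast Nat.le_add_left j m
      have hj0 : (0 : ℝ) ≤ j := j.cast_nonneg
      have h3 : (1 + ε') * ((j + 1 : ℕ) : ℝ) ≤ (1 + ε) * (j + 1) := by
        push_cast; gcongr
      have h4 : ε' * ((m + j : ℕ) : ℝ) ≤ ε * ((m + j : ℕ) : ℝ) := by gcongr
      have h5 : (1 - 1 / lam + 2 * ε) * (j : ℝ) ≤ (M + 2 * ε) * ((m + j : ℕ) : ℝ) :=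
        (mul_le_mul_of_nonneg_right (by linarith) hj0).trans
          (mul_le_mul_of_nonneg_left hj (by linarith))
      linarith
    have h6 := mul_lt_mul_of_pos_right hεc hn0'
    linarith

/-- The mean velocity of a car follows from the order of growth of its exit times. -/
theorem IsSlowToStart.tendsto_neg_pos_div {lam : ℝ} (hlam : 0 < lam) {y : ℤ → ℝ}
    {x : ℤ × ℕ → ℝ} {pos v : ℤ → ℝ → ℝ}
    (h : IsSlowToStart y (fun k => clockPoints fun l => x (k, l)) pos v) (hmono : StrictMono y)
    (hx : ∀ p, 0 < x p) (i : ℤ)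
    (hy : Tendsto (fun n : ℕ => y (i - n) / n) atTop (𝓝 (-(1 / lam))))
    (hS : Tendsto (fun n : ℕ => exitTime y x n (i - n) / n) atTop (𝓝 (max (1 - 1 / lam) 0))) :
    Tendsto (fun t => -(pos i t) / t) atTop (𝓝 (min (1 / lam) 1)) := by
  have hl : 0 < 1 / lam := by positivity
  have hmax : max (1 - 1 / lam) 0 - -(1 / lam) = max 1 (1 / lam) := by
    rw [sub_neg_eq_add, ← max_add_add_right]; simp
  have hval : 1 / lam / max 1 (1 / lam) = min (1 / lam) 1 := by
    rcases le_total 1 (1 / lam) with h1 | h1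
    · rw [max_eq_right h1, min_eq_right h1, div_self hl.ne']
    · rw [max_eq_left h1, min_eq_left h1, div_one]
  rw [← hval]
  refine tendsto_div_of_monotoneOn_of_sampled (g := fun t => -(pos i t))
    (T := fun n => exitTime y x n (i - n) - y (i - n)) ?_ ?_ (lt_max_of_lt_left one_pos) hl ?_ ?_
  · intro s hs t _ hst
    exact neg_le_neg (h.pos_antitone i hs hst)
  · exact fun n => (sub_pos.2 (lt_exitTime hx n _)).le
  · rw [← hmax]
    refine (hS.sub hy).congr fun n => ?_
    rw [sub_div]
  · have := hy.neg
    rw [neg_neg] at this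
    refine this.congr fun n => ?_
    rw [(h.departure hmono hx n (i - n) i (by ring)).1, neg_div]

theorem proposition2 {Ω : Type*} [MeasurableSpace Ω] (P : Measure Ω) [IsProbabilityMeasure P]
    (lam : ℝ) (hlam : 0 < lam)
    (y : ℤ → Ω → ℝ) (hy : IsLabelledPoisson P lam y)
    (ξ : ℤ → ℕ → Ω → ℝ) (hξ : AreIndepClocks P y ξ)
    (pos v : ℤ → ℝ → Ω → ℝ)
    (hdyn : ∀ᵐ ω ∂P, IsSlowToStart (fun i => y i ω)
      (fun k => clockPoints (fun l => ξ k l ω))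
      (fun i t => pos i t ω) (fun i t => v i t ω)) :
    ∀ i : ℤ, ∀ᵐ ω ∂P,
      Tendsto (fun t : ℝ => -(pos i t ω) / t) atTop (𝓝 (min (1 / lam) 1)) := by
  intro i
  have hupper := ae_all_iff.2 fun q : ℕ =>
    hξ.ae_eventually_sum_serviceTime_le hy.measurable i (Nat.one_div_pos_of_nat (α := ℝ) (n := q))
  have hlower := ae_all_iff.2 fun q : ℕ =>
    hξ.ae_eventually_le_sum_serviceTime hy.measurable i (Nat.one_div_pos_of_nat (α := ℝ) (n := q))
  filter_upwards [hdyn, hy.strictMono, hy.ae_tendsto_div hlam i, hξ.ae_pos, hupper, hlower]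
    with ω hω hmono hyω hpos hup hlow
  refine hω.tendsto_neg_pos_div (x := fun p => ξ p.1 p.2 ω) hlam hmono hpos i hyω
    (tendsto_exitTime_div hpos i hyω ?_ ?_)
  · intro ε hε
    obtain ⟨q, hq⟩ := exists_nat_one_div_lt hε
    exact ⟨_, Nat.one_div_pos_of_nat, hq.le, hup q⟩
  · intro ε hε
    obtain ⟨q, hq⟩ := exists_nat_one_div_lt hε
    exact ⟨_, Nat.one_div_pos_of_nat, hq.le, hlow q⟩
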